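/- Let $E$ be a Polish space with complete metric $d$ and Borel $\sigma$-field, let $P$ be any Markov transition kernel on $E$, let $h:E\to\mathbb{R}^n$ be measurable, and let $\xi$ be a probability measure on $\mathbb{R}^n$. For a probability measure $\mu$ on $E$, let $\mathbf{P}^\mu$ be the law on $E^{\mathbb{Z}_+}\times(\mathbb{R}^n)^{\mathbb{Z}_+}$, with coordinate processes $(X_k)_{k\ge 0}$ and $(Y_k)_{k\ge 0}$, under which $(X_k)$ is a Markov chain with initial law $\mu$ and transition kernel $P$, and $Y_k=h(X_k)+\xi_k$, where $(\xi_k)_{k\ge 0}$ is i.i.d. with law $\xi$ and independent of $(X_k)$. Write $\mathbf{E}^\mu$ for the expectation under $\mathbf{P}^\mu$, and let $\pi_k^\mu$ be the nonlinear filter, i.e. the regular conditional law $\mathbf{P}^\mu(X_k\in\cdot\,|\,Y_0,\ldots,Y_k)$, regarded as a measure-valued function of $(Y_0,\ldots,Y_k)$. For probability measures $\rho,\rho'$ on $E$ put $$\|\rho-\rho'\|_{\rm BL}=\sup\Big\{\Big|\int f\,d\rho-\int f\,d\rho'\Big| : f:E\to\mathbb{R},\ |f|\le 1,\ |f(x)-f(y)|\le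 d(x,y)\text{ for all }x,y\in E\Big\}.$$ Assume that 1. $h$ has a uniformly continuous inverse: there is a uniformly continuous $g:\mathbb{R}^n\to E$ with $g(h(x))=x$ for all $x\in E$; 2. $\xi$ has a density $q_\xi$ with respect to the Lebesgue measure on $\mathbb{R}^n$; 3. the Fourier transform of $q_\xi$ vanishes nowhere. Then for all probability measures $\mu,\nu$ on $E$ such that $\mathbf{P}^\mu|_{\sigma\{(Y_k)_{k\ge 0}\}}\ll\mathbf{P}^\nu|_{\sigma\{(Y_k)_{k\ge 0}\}}$, the random variables $\|\pi_k^\mu-\pi_k^\nu\|_{\rm BL}$ are $\mathbf{P}^\mu$-integrable and $$\mathbf{E}^\mu\big(\|\pi_k^\mu-\pi_k^\nu\|_{\rm BL}\big)\xrightarrow{k\to\infty}0.$$ -/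

import Mathlib

open MeasureTheory ProbabilityTheory

noncomputable section

/-- The dual bounded-Lipschitz distance `‖μ - ν‖_BL`: the supremum of `|∫ f dμ - ∫ f dν|` over all
`f` with `‖f‖_∞ ≤ 1` and Lipschitz constant at most `1`. For probability measures the supremum is
over a nonempty set of reals bounded by `2`. -/
def blDist {S : Type*} [MetricSpace S] [MeasurableSpace S] (μ ν : Measure S) : ℝ :=
  ⨆ f : {f : S → ℝ // (∀ x, |f x| ≤ 1) ∧ LipschitzWith 1 f},
    |(∫ x, f.1 x ∂μ) - ∫ x, f.1 x ∂ν|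

section HiddenMarkovModel

variable {E : Type*} [MeasurableSpace E] {n : ℕ}

/-- The law on `E^ℕ` of the Markov chain with initial law `μ` and transition kernel `P`. -/
def signalLaw (P : Kernel E E) [IsMarkovKernel P] (μ : Measure E) [IsProbabilityMeasure μ] :
    Measure (ℕ → E) :=
  Kernel.trajMeasure (X := fun _ => E) μ
    fun k => P.comap (fun x : (i : Finset.Iic k) → E => x ⟨k, by simp⟩) (measurable_pi_apply _)

/-- The measure `𝐏^μ` on `Ω = E^ℕ × (ℝⁿ)^ℕ`: the joint law of `(X_k)` and of `(Y_k)`, where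
`Y_k = h (X_k) + ξ_k`, `(X_k)` is the Markov chain with initial law `μ` and transition kernel `P`,
and `(ξ_k)` is i.i.d. with law `ξ` and independent of `(X_k)`. -/
def hmmLaw (P : Kernel E E) [IsMarkovKernel P] (h : E → EuclideanSpace ℝ (Fin n))
    (ξ : Measure (EuclideanSpace ℝ (Fin n))) [IsProbabilityMeasure ξ]
    (μ : Measure E) [IsProbabilityMeasure μ] :
    Measure ((ℕ → E) × (ℕ → EuclideanSpace ℝ (Fin n))) :=
  ((signalLaw P μ).prod (Measure.infinitePi fun _ : ℕ => ξ)).map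
    fun p => (p.1, fun k => h (p.1 k) + p.2 k)

instance (P : Kernel E E) [IsMarkovKernel P] (h : E → EuclideanSpace ℝ (Fin n))
    (ξ : Measure (EuclideanSpace ℝ (Fin n))) [IsProbabilityMeasure ξ]
    (μ : Measure E) [IsProbabilityMeasure μ] : IsFiniteMeasure (hmmLaw P h ξ μ) := by
  unfold hmmLaw signalLaw
  infer_instance

/-- The sigma-field `σ{(Y_k)_{k ≥ 0}}` on `Ω`. -/
@[reducible] def obsSigma (E : Type*) (n : ℕ) :
    MeasurableSpace ((ℕ → E) × (ℕ → EuclideanSpace ℝ (Fin n))) :=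
  ⨆ k : ℕ, MeasurableSpace.comap (fun ω => ω.2 k) inferInstance

theorem obsSigma_le (E : Type*) [MeasurableSpace E] (n : ℕ) :
    obsSigma E n ≤ (inferInstance :
      MeasurableSpace ((ℕ → E) × (ℕ → EuclideanSpace ℝ (Fin n)))) :=
  iSup_le fun k => ((measurable_pi_apply k).comp measurable_snd).comap_le

/-- The first observations `(Y_0, …, Y_k)`. -/
def obsUpTo (k : ℕ) (ω : (ℕ → E) × (ℕ → EuclideanSpace ℝ (Fin n))) :
    Finset.Iic k → EuclideanSpace ℝ (Fin n) :=
  fun i => ω.2 i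

/-- The nonlinear filter `π_k^μ`: the regular conditional law of `X_k` given `Y_0, …, Y_k`
under `𝐏^μ`, as a random probability measure on `E`. -/
def nonlinearFilter [StandardBorelSpace E] [Nonempty E] (P : Kernel E E) [IsMarkovKernel P]
    (h : E → EuclideanSpace ℝ (Fin n)) (ξ : Measure (EuclideanSpace ℝ (Fin n)))
    [IsProbabilityMeasure ξ] (μ : Measure E) [IsProbabilityMeasure μ]
    (k : ℕ) (ω : (ℕ → E) × (ℕ → EuclideanSpace ℝ (Fin n))) : Measure E :=
  condDistrib (fun ω : (ℕ → E) × (ℕ → EuclideanSpace ℝ (Fin n)) => ω.1 k) (obsUpTo k)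
    (hmmLaw P h ξ μ) (obsUpTo k ω)

end HiddenMarkovModel

end

/-!
The observation at time `k + 1` carries noise that is independent of the signal and of the earlier
observations, and this freshness is all that the proof uses of the model; the Markov property of the
signal plays no role. Write `κ`, `κ'` for the conditional laws of `X_{k+1}` given `Y_0, …, Y_k`
under `𝐏^μ` and `𝐏^ν`. The argument links three distances.

*Predictive laws of the observations merge.* The likelihood ratio of `Y_0, …, Y_k` under the two laws
is a martingale closed by an integrable variable, because the laws of the whole observation
sequence satisfy `≪`. By Lévy's upward theorem its increments tend to `0` in `L¹`
(`tendsto_lintegral_likelihood_sub`), and they bound the mean `L¹` distance of the conditional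
densities `q * (κ ∘ h⁻¹)` and `q * (κ' ∘ h⁻¹)` of `Y_{k+1}` (`lintegral_obsDensity_sub_le`).

*Deconvolution.* As `q̂` has no zeros, a Tauberian theorem of Wiener's type holds in the form
`‖(σ - σ') * ψ‖₁ ≤ ε + C ‖(σ - σ') * q‖₁` for every `ψ ∈ L¹`, with `C` depending on `ψ` and `ε` but
not on the probability measures `σ, σ'` (`exists_forall_convDiffNorm_le`). Uniformity in the
measures is needed, because the predictive laws vary with `k` and need not be tight. Instead of
inverting `q̂` in the Wiener algebra, the proof perturbs `q` near each frequency `t₀` to the constant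
`q̂(t₀)` and absorbs the error into the left side, which is finite
(`exists_forall_convDominated_of_spectrum_subset`); a partition of unity treats compactly supported
spectra, and band-limited functions are dense in `L¹`.

*From observations to the filter.* By Bayes' formula the filter at time `k + 1` is
`f ↦ ∫ f(x) q(y - h x) κ(dx) / ∫ q(y - h x) κ(dx)`, and the difference of two such quotients is
controlled by the differences of numerators and of denominators (`ofReal_blDist_mul_le`). For the
numerators a bound in `L¹(dy)` of the supremum over the bounded-Lipschitz ball is required. Cut `q`
into pieces `ψ_i` supported in small cells about points `c_i`. Where `ψ_i(y - h x) ≠ 0`, the point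
`h x` is close to `y - c_i`, hence `f x = f (g (h x))` is close to `f (g (y - c_i))`, uniformly in
`f`, by uniform continuity of `g`. The numerators are thus nearly combinations of the finitely many
convolutions `ψ_i * (κ ∘ h⁻¹)` with coefficients at most `1`, to which the second step applies
(`exists_bound_unnormalized_update`).
-/

open Filter Topology ContinuousLinearMap
open scoped ENNReal NNReal Convolution FourierTransform SchwartzMap

/-! ### Convolution of a difference of probability measures with an integrable function -/

section Deconvolution

set_option linter.unusedSectionVars false

variable {V : Type*} [NormedAddCommGroup V] [InnerProductSpace ℝ V] [FiniteDimensional ℝ V]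
  [MeasurableSpace V] [BorelSpace V]

/-- The convolution `(σ - σ') * ψ` of a difference of two measures with a function. -/
noncomputable def convDiff (σ σ' : Measure V) (ψ : V → ℂ) (y : V) : ℂ :=
  (∫ u, ψ (y - u) ∂σ) - ∫ u, ψ (y - u) ∂σ'

/-- The `L¹` norm of `(σ - σ') * ψ`. -/
noncomputable def convDiffNorm (σ σ' : Measure V) (ψ : V → ℂ) : ℝ≥0∞ :=
  ∫⁻ y, ‖convDiff σ σ' ψ y‖ₑ

theorem measure_convolution_eq (σ : Measure V) (ψ : V → ℂ) (y : V) :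
    ((fun _ => (1 : ℂ)) ⋆[mul ℂ ℂ, σ] ψ) y = ∫ u, ψ (y - u) ∂σ := by
  simp [convolution_def]

theorem convDiff_eq (σ σ' : Measure V) (ψ : V → ℂ) :
    convDiff σ σ' ψ = ((fun _ => (1 : ℂ)) ⋆[mul ℂ ℂ, σ] ψ) - (fun _ => (1 : ℂ)) ⋆[mul ℂ ℂ, σ'] ψ := by
  ext y
  simp only [convDiff, Pi.sub_apply, measure_convolution_eq]

variable (σ σ' : Measure V) [IsProbabilityMeasure σ] [IsProbabilityMeasure σ']

theorem ae_integrable_comp_sub {ψ : V → ℂ} (hψ : Integrable ψ) :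
    ∀ᵐ y, Integrable (fun u => ψ (y - u)) σ := by
  have h := (integrable_const (1 : ℂ)).ae_convolution_exists (ν := σ) (mul ℂ ℂ) hψ
  filter_upwards [h] with y hy
  simpa [ConvolutionExistsAt] using hy

theorem integrable_measure_convolution {ψ : V → ℂ} (hψ : Integrable ψ) :
    Integrable ((fun _ => (1 : ℂ)) ⋆[mul ℂ ℂ, σ] ψ) :=
  ((integrable_const (1 : ℂ)).convolution_integrand (ν := σ) (mul ℂ ℂ) hψ).integral_prod_left

theorem integrable_convDiff {ψ : V → ℂ} (hψ : Integrable ψ) : Integrable (convDiff σ σ' ψ) := by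
  rw [convDiff_eq]
  exact (integrable_measure_convolution σ hψ).sub (integrable_measure_convolution σ' hψ)

theorem lintegral_enorm_integral_sub_le {ψ : V → ℂ} (hψ : AEStronglyMeasurable ψ volume) :
    ∫⁻ y, ‖∫ u, ψ (y - u) ∂σ‖ₑ ≤ ∫⁻ y, ‖ψ y‖ₑ := by
  have hm : AEMeasurable (fun p : V × V => ‖ψ (p.1 - p.2)‖ₑ) (volume.prod σ) := by
    have := (aestronglyMeasurable_const (b := (1 : ℂ)) (μ := σ)).convolution_integrand
      (ν := σ) (mul ℂ ℂ) hψ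
    simpa using this.enorm
  calc ∫⁻ y, ‖∫ u, ψ (y - u) ∂σ‖ₑ ≤ ∫⁻ y, ∫⁻ u, ‖ψ (y - u)‖ₑ ∂σ :=
        lintegral_mono fun y => enorm_integral_le_lintegral_enorm _
    _ = ∫⁻ u, (∫⁻ y, ‖ψ (y - u)‖ₑ) ∂σ := by
        rw [lintegral_lintegral_swap hm]
    _ = ∫⁻ y, ‖ψ y‖ₑ := by
        simp_rw [lintegral_sub_right_eq_self (fun y => ‖ψ y‖ₑ)]
        simp

theorem convDiffNorm_le {ψ : V → ℂ} (hψ : Integrable ψ) :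
    convDiffNorm σ σ' ψ ≤ 2 * ∫⁻ y, ‖ψ y‖ₑ := by
  have hm := (integrable_measure_convolution σ hψ).aestronglyMeasurable.enorm
  simp only [measure_convolution_eq] at hm
  calc convDiffNorm σ σ' ψ ≤ ∫⁻ y, (‖∫ u, ψ (y - u) ∂σ‖ₑ + ‖∫ u, ψ (y - u) ∂σ'‖ₑ) :=
        lintegral_mono fun y => enorm_sub_le
    _ = (∫⁻ y, ‖∫ u, ψ (y - u) ∂σ‖ₑ) + ∫⁻ y, ‖∫ u, ψ (y - u) ∂σ'‖ₑ :=
        lintegral_add_left' hm _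
    _ ≤ 2 * ∫⁻ y, ‖ψ y‖ₑ := by
        rw [two_mul]
        exact add_le_add (lintegral_enorm_integral_sub_le σ hψ.1)
          (lintegral_enorm_integral_sub_le σ' hψ.1)

theorem convDiff_add_ae {ψ χ : V → ℂ} (hψ : Integrable ψ) (hχ : Integrable χ) :
    convDiff σ σ' (ψ + χ) =ᵐ[volume] convDiff σ σ' ψ + convDiff σ σ' χ := by
  filter_upwards [ae_integrable_comp_sub σ hψ, ae_integrable_comp_sub σ hχ,
    ae_integrable_comp_sub σ' hψ, ae_integrable_comp_sub σ' hχ] with y h1 h2 h3 h4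
  simp only [convDiff, Pi.add_apply]
  rw [integral_add h1 h2, integral_add h3 h4]
  ring

theorem convDiffNorm_add_le {ψ χ : V → ℂ} (hψ : Integrable ψ) (hχ : Integrable χ) :
    convDiffNorm σ σ' (ψ + χ) ≤ convDiffNorm σ σ' ψ + convDiffNorm σ σ' χ := by
  have h := convDiff_add_ae σ σ' hψ hχ
  calc convDiffNorm σ σ' (ψ + χ)
      = ∫⁻ y, ‖convDiff σ σ' ψ y + convDiff σ σ' χ y‖ₑ :=
        lintegral_congr_ae (h.mono fun y hy => by simp [hy])
    _ ≤ ∫⁻ y, (‖convDiff σ σ' ψ y‖ₑ + ‖convDiff σ σ' χ y‖ₑ) :=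
        lintegral_mono fun y => enorm_add_le _ _
    _ = _ := lintegral_add_left' (integrable_convDiff σ σ' hψ).1.enorm _

theorem convDiffNorm_const_mul (c : ℂ) (ψ : V → ℂ) :
    convDiffNorm σ σ' (fun x => c * ψ x) = ‖c‖ₑ * convDiffNorm σ σ' ψ := by
  have h : ∀ y, convDiff σ σ' (fun x => c * ψ x) y = c * convDiff σ σ' ψ y := fun y => by
    simp only [convDiff, integral_const_mul, mul_sub]
  simp only [convDiffNorm, h, enorm_mul]
  rw [lintegral_const_mul' _ _ enorm_ne_top]

theorem convDiffNorm_congr_ae {ψ χ : V → ℂ} (hψ : Integrable ψ) (h : ψ =ᵐ[volume] χ) :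
    convDiffNorm σ σ' ψ = convDiffNorm σ σ' χ := by
  have hχ : Integrable χ := hψ.congr h
  have key : ∀ {f g : V → ℂ}, Integrable f → Integrable g → f =ᵐ[volume] g →
      convDiffNorm σ σ' (f - g) = 0 := fun {f g} hf hg hfg => by
    refine le_antisymm ((convDiffNorm_le σ σ' (hf.sub hg)).trans ?_) zero_le
    rw [lintegral_congr_ae (g := fun _ => 0) (hfg.mono fun y hy => by simp [hy])]
    simp
  apply le_antisymm
  · have := convDiffNorm_add_le σ σ' hχ (hψ.sub hχ)
    simpa [key hψ hχ h] using this
  · have := convDiffNorm_add_le σ σ' hψ (hχ.sub hψ)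
    simpa [key hχ hψ h.symm] using this

theorem measure_convolution_assoc {ψ χ : V → ℂ} (hψ : Integrable ψ) (hχ : Integrable χ) :
    ∀ᵐ y, ((fun _ => (1 : ℂ)) ⋆[mul ℂ ℂ, σ] (ψ ⋆[mul ℂ ℂ] χ)) y =
      (((fun _ => (1 : ℂ)) ⋆[mul ℂ ℂ, σ] ψ) ⋆[mul ℂ ℂ] χ) y := by
  have hint : Integrable (fun p : V × V => ψ (p.1 - p.2)) (volume.prod σ) := by
    simpa using (integrable_const (1 : ℂ)).convolution_integrand (ν := σ) (mul ℂ ℂ) hψ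
  filter_upwards [hint.norm.integral_prod_left.ae_convolution_exists (mul ℝ ℝ) hχ.norm] with y hy
  have hχy : AEStronglyMeasurable (fun t => χ (y - t)) volume :=
    hχ.1.comp_quasiMeasurePreserving (quasiMeasurePreserving_sub_left_of_right_invariant volume y)
  have hint' : Integrable (fun p : V × V => ψ (p.1 - p.2) * χ (y - p.1)) (volume.prod σ) := by
    refine (integrable_prod_iff (hint.1.mul hχy.comp_fst)).2
      ⟨(ae_integrable_comp_sub σ hψ).mono fun t ht => ht.mul_const (χ (y - t)), ?_⟩
    simpa [ConvolutionExistsAt, integral_mul_const] using hy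
  rw [measure_convolution_eq, convolution_def]
  simp only [convolution_def, mul_apply', one_mul]
  calc ∫ u, (∫ s, ψ s * χ (y - u - s)) ∂σ = ∫ u, (∫ t, ψ (t - u) * χ (y - t)) ∂σ := by
        congr 1 with u
        rw [← integral_sub_right_eq_self _ u]
        simp only [sub_sub_sub_cancel_right]
    _ = ∫ t, ∫ u, ψ (t - u) * χ (y - t) ∂σ := (integral_integral_swap hint').symm
    _ = ∫ t, (∫ u, ψ (t - u) ∂σ) * χ (y - t) := by simp only [integral_mul_const]

/-- Young's inequality `‖((σ - σ') * ψ) * χ‖₁ ≤ ‖(σ - σ') * ψ‖₁ ‖χ‖₁`, read through the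
associativity of convolution. -/
theorem convDiffNorm_convolution_le {ψ χ : V → ℂ} (hψ : Integrable ψ) (hχ : Integrable χ) :
    convDiffNorm σ σ' (ψ ⋆[mul ℂ ℂ] χ) ≤ convDiffNorm σ σ' ψ * ∫⁻ y, ‖χ y‖ₑ := by
  have hD := integrable_convDiff σ σ' hψ
  have key : convDiff σ σ' (ψ ⋆[mul ℂ ℂ] χ) =ᵐ[volume] convDiff σ σ' ψ ⋆[mul ℂ ℂ] χ := by
    filter_upwards [measure_convolution_assoc σ hψ hχ, measure_convolution_assoc σ' hψ hχ,
      (integrable_measure_convolution σ hψ).ae_convolution_exists (mul ℂ ℂ) hχ,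
      (integrable_measure_convolution σ' hψ).ae_convolution_exists (mul ℂ ℂ) hχ]
      with y h1 h2 h3 h4
    rw [convDiff_eq, convDiff_eq, Pi.sub_apply, h1, h2]
    simp only [ConvolutionExistsAt, mul_apply'] at h3 h4
    simp only [convolution_def (L := mul ℂ ℂ) (μ := volume), mul_apply', Pi.sub_apply, sub_mul]
    rw [integral_sub h3 h4]
  have hm : AEMeasurable (fun p : V × V => ‖convDiff σ σ' ψ p.2‖ₑ * ‖χ (p.1 - p.2)‖ₑ)
      (volume.prod volume) := by
    have := hD.1.convolution_integrand (mul ℂ ℂ) hχ.1 (ν := volume)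
    simpa [enorm_mul] using this.enorm
  calc convDiffNorm σ σ' (ψ ⋆[mul ℂ ℂ] χ)
      = ∫⁻ y, ‖(convDiff σ σ' ψ ⋆[mul ℂ ℂ] χ) y‖ₑ :=
        lintegral_congr_ae (key.mono fun y hy => by simp only [hy])
    _ ≤ ∫⁻ y, ∫⁻ s, ‖convDiff σ σ' ψ s‖ₑ * ‖χ (y - s)‖ₑ := by
        refine lintegral_mono fun y => ?_
        rw [convolution_def]
        refine (enorm_integral_le_lintegral_enorm _).trans (le_of_eq ?_)
        simp [enorm_mul]
    _ = ∫⁻ s, ∫⁻ y, ‖convDiff σ σ' ψ s‖ₑ * ‖χ (y - s)‖ₑ := lintegral_lintegral_swap hm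
    _ = ∫⁻ s, ‖convDiff σ σ' ψ s‖ₑ * ∫⁻ y, ‖χ y‖ₑ := by
        refine lintegral_congr fun s => ?_
        rw [lintegral_const_mul' _ _ enorm_ne_top,
          lintegral_sub_right_eq_self (fun y => ‖χ y‖ₑ)]
    _ = _ := by
        rw [lintegral_mul_const'' _ hD.1.enorm]
        rfl

end Deconvolution

/-! ### Translation modulus and band-limited kernels -/

section Kernels

set_option linter.unusedSectionVars false

variable {V : Type*} [NormedAddCommGroup V] [InnerProductSpace ℝ V] [FiniteDimensional ℝ V]
  [MeasurableSpace V] [BorelSpace V]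

/-- The `L¹` modulus of continuity of `ψ` under translations. -/
noncomputable def translModulus (ψ : V → ℂ) (s : V) : ℝ≥0∞ :=
  ∫⁻ y, ‖ψ (y - s) - ψ y‖ₑ

theorem translModulus_le {ψ : V → ℂ} (hψ : Integrable ψ) (s : V) :
    translModulus ψ s ≤ 2 * ∫⁻ y, ‖ψ y‖ₑ := by
  calc translModulus ψ s ≤ ∫⁻ y, (‖ψ (y - s)‖ₑ + ‖ψ y‖ₑ) := lintegral_mono fun y => enorm_sub_le
    _ = (∫⁻ y, ‖ψ (y - s)‖ₑ) + ∫⁻ y, ‖ψ y‖ₑ := lintegral_add_right' _ hψ.1.enorm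
    _ = 2 * ∫⁻ y, ‖ψ y‖ₑ := by
        rw [lintegral_sub_right_eq_self (fun y => ‖ψ y‖ₑ), two_mul]

theorem continuous_translModulus {ψ : V → ℂ} (hψ : Integrable ψ) :
    Continuous (translModulus ψ) := by
  have hψ1 : MemLp ψ 1 volume := memLp_one_iff_integrable.2 hψ
  let g : C(V, C(V, V)) := (ContinuousMap.mk (fun p : V × V => p.2 - p.1) (by fun_prop)).curry
  have hg : ∀ s, MeasurePreserving (g s) volume volume := fun s =>
    measurePreserving_sub_right volume s
  have hc : Continuous fun s => Lp.compMeasurePreserving (g s) (hg s) (hψ1.toLp ψ) :=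
    Continuous.compMeasurePreservingLp continuous_const g.continuous hg ENNReal.one_ne_top
  have heq : translModulus ψ =
      fun s => edist (Lp.compMeasurePreserving (g s) (hg s) (hψ1.toLp ψ)) (hψ1.toLp ψ) := by
    ext s
    rw [Lp.toLp_compMeasurePreserving, Lp.edist_toLp_toLp, eLpNorm_one_eq_lintegral_enorm]
    rfl
  rw [heq]
  exact hc.edist continuous_const

theorem translModulus_zero (ψ : V → ℂ) : translModulus ψ 0 = 0 := by
  simp [translModulus]

theorem lintegral_pow_mul_comp_smul {r : ℝ} (hr : 0 < r) (f : V → ℝ≥0∞) :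
    ∫⁻ x, ENNReal.ofReal (r ^ Module.finrank ℝ V) * f (r • x) = ∫⁻ x, f x := by
  have h1 : ∫⁻ x, f (r • x) = ENNReal.ofReal (r ^ Module.finrank ℝ V)⁻¹ * ∫⁻ x, f x := by
    have h := lintegral_map_equiv (μ := (volume : Measure V)) f
      (Homeomorph.smulOfNeZero r hr.ne').toMeasurableEquiv
    have h2 : Measure.map (Homeomorph.smulOfNeZero r hr.ne').toMeasurableEquiv
        (volume : Measure V) = ENNReal.ofReal (r ^ Module.finrank ℝ V)⁻¹ • volume := by
      have := Measure.map_addHaar_smul (volume : Measure V) hr.ne'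
      rw [abs_of_pos (by positivity)] at this
      exact this
    rw [h2, lintegral_smul_measure] at h
    exact h.symm
  have hpos : 0 < r ^ Module.finrank ℝ V := by positivity
  rw [lintegral_const_mul' _ _ ENNReal.ofReal_ne_top, h1, ← mul_assoc,
    ← ENNReal.ofReal_mul hpos.le, mul_inv_cancel₀ hpos.ne', ENNReal.ofReal_one, one_mul]

/-- Band-limited kernels: modulated dilates `K x = r ^ d e(⟪t₀, x⟫) W (r x)` of one Schwartz
function `W`. The Fourier transform of `K` has compact support and is `1` on the ball of radius `r`
about `t₀`. -/
theorem exists_bandLimited_kernels : ∃ W : 𝓢(V, ℂ), ∀ r : ℝ, 0 < r → ∀ t₀ : V,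
    ∃ K : 𝓢(V, ℂ),
      (∀ x, K x = (r ^ Module.finrank ℝ V : ℝ) • Real.fourierChar (inner ℝ t₀ x) • W (r • x)) ∧
      (∀ t, dist t t₀ ≤ r → 𝓕 K t = 1) ∧ HasCompactSupport ⇑(𝓕 K : 𝓢(V, ℂ)) := by
  let b : ContDiffBump (0 : V) := ⟨1, 2, one_pos, one_lt_two⟩
  have hsm : ∀ (r : ℝ) (t₀ : V), ContDiff ℝ (⊤ : ℕ∞) fun t => ((b (r⁻¹ • (t - t₀)) : ℝ) : ℂ) := by
    intro r t₀
    exact Complex.ofRealCLM.contDiff.comp (b.contDiff.comp (by fun_prop))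
  have hcs : ∀ (r : ℝ), 0 < r → ∀ (t₀ : V),
      HasCompactSupport fun t => ((b (r⁻¹ • (t - t₀)) : ℝ) : ℂ) := by
    intro r hr t₀
    have h1 : HasCompactSupport fun t => b (r⁻¹ • (t - t₀)) :=
      b.hasCompactSupport.comp_homeomorph
        ((Homeomorph.subRight t₀).trans (Homeomorph.smulOfNeZero r⁻¹ (inv_ne_zero hr.ne')))
    exact h1.comp_left (g := fun x : ℝ => (x : ℂ)) Complex.ofReal_zero
  have hb : HasCompactSupport fun t => ((b t : ℝ) : ℂ) := by
    simpa using hcs 1 one_pos 0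
  have hbs : ContDiff ℝ (⊤ : ℕ∞) fun t => ((b t : ℝ) : ℂ) := by simpa using hsm 1 0
  refine ⟨𝓕⁻ (hb.toSchwartzMap hbs), fun r hr t₀ =>
    ⟨𝓕⁻ ((hcs r hr t₀).toSchwartzMap (hsm r t₀)), ?_, ?_, ?_⟩⟩
  · intro x
    rw [SchwartzMap.fourierInv_coe, SchwartzMap.fourierInv_coe, Real.fourierInv_eq,
      Real.fourierInv_eq]
    change ∫ t, Real.fourierChar (inner ℝ t x) • ((b (r⁻¹ • (t - t₀)) : ℝ) : ℂ) =
      (r ^ Module.finrank ℝ V : ℝ) • Real.fourierChar (inner ℝ t₀ x) •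
        ∫ s, Real.fourierChar (inner ℝ s (r • x)) • ((b s : ℝ) : ℂ)
    let F : V → ℂ := fun s =>
      Real.fourierChar (inner ℝ t₀ x) • Real.fourierChar (inner ℝ s (r • x)) • ((b s : ℝ) : ℂ)
    have h1 : ∀ t, Real.fourierChar (inner ℝ (t + t₀) x) •
        ((b (r⁻¹ • (t + t₀ - t₀)) : ℝ) : ℂ) = F (r⁻¹ • t) := fun t => by
      have : inner ℝ (r⁻¹ • t) (r • x) = inner ℝ t x := by
        rw [inner_smul_left, inner_smul_right]
        simp [hr.ne']
      simp only [F, this, smul_smul, ← AddChar.map_add_eq_mul, inner_add_left,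
        add_sub_cancel_right, add_comm (inner ℝ t x)]
    rw [← integral_add_right_eq_self _ t₀]
    simp only [h1]
    rw [Measure.integral_comp_inv_smul, abs_of_pos (by positivity)]
    congr 1
    simp only [F, Circle.smul_def]
    rw [integral_smul]
  · intro t ht
    rw [FourierTransform.fourier_fourierInv_eq]
    have : b (r⁻¹ • (t - t₀)) = 1 := b.one_of_mem_closedBall (by
      rw [mem_closedBall_zero_iff, norm_smul, norm_inv, Real.norm_of_nonneg hr.le,
        ← dist_eq_norm]
      exact (inv_mul_le_one₀ hr).2 ht)
    simp [this]
  · simp only [FourierTransform.fourier_fourierInv_eq]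
    exact hcs r hr t₀

end Kernels

/-! ### Localization in frequency and approximate identities in `L¹` -/

section Wiener

set_option linter.unusedSectionVars false

variable {V : Type*} [NormedAddCommGroup V] [InnerProductSpace ℝ V] [FiniteDimensional ℝ V]
  [MeasurableSpace V] [BorelSpace V]

theorem aestronglyMeasurable_comp_sub_prod {ψ : V → ℂ} (hψ : Integrable ψ) :
    AEStronglyMeasurable (fun p : V × V => ψ (p.1 - p.2)) (volume.prod volume) := by
  have := (aestronglyMeasurable_const (b := (1 : ℂ)) (μ := (volume : Measure V))).convolution_integrand
      (mul ℂ ℂ) hψ.1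
  simpa using this

/-- Near the frequency `t₀`, the Fourier transform of `q` is nearly constant, in the sense of the
Wiener algebra: `K * q - q̂(t₀) K` is small in `L¹` if the kernel `K` is concentrated at `t₀`. -/
theorem lintegral_kernel_convolution_sub_le {q : V → ℂ} (hq : Integrable q) (W K : 𝓢(V, ℂ))
    {r : ℝ} (hr : 0 < r) (t₀ : V)
    (hK : ∀ x, K x = (r ^ Module.finrank ℝ V : ℝ) • Real.fourierChar (inner ℝ t₀ x) • W (r • x)) :
    ∫⁻ x, ‖(K ⋆[mul ℂ ℂ] q) x - 𝓕 q t₀ * K x‖ₑ ≤ ∫⁻ s, ‖q s‖ₑ * translModulus W (r • s) := by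
  have hint : ∀ x, Integrable fun s => K (x - s) * q s := fun x => by
    refine hq.bdd_mul (c := SchwartzMap.seminorm ℝ 0 0 K) ?_ (Eventually.of_forall fun s => ?_)
    · exact (K.continuous.comp (by fun_prop)).aestronglyMeasurable
    · exact K.norm_le_seminorm ℝ _
  have hint2 : ∀ x, Integrable fun s => (Real.fourierChar (-inner ℝ s t₀) • q s) * K x := fun x => by
    refine Integrable.mul_const ?_ _
    exact (Real.fourierIntegral_convergent_iff t₀).2 hq
  have hpt : ∀ x, (K ⋆[mul ℂ ℂ] q) x - 𝓕 q t₀ * K x =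
      ∫ s, q s * (K (x - s) - Real.fourierChar (-inner ℝ s t₀) • K x) := fun x => by
    rw [convolution_mul_swap, Real.fourier_eq, ← integral_mul_const, ← integral_sub (hint x) (hint2 x)]
    congr 1 with s
    simp only [Circle.smul_def, smul_eq_mul]
    ring
  -- the phases combine to a common factor of modulus one
  have hnorm : ∀ x s, ‖K (x - s) - Real.fourierChar (-inner ℝ s t₀) • K x‖ₑ =
      ENNReal.ofReal (r ^ Module.finrank ℝ V) * ‖W (r • x - r • s) - W (r • x)‖ₑ := fun x s => by
    have : K (x - s) - Real.fourierChar (-inner ℝ s t₀) • K x =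
        (r ^ Module.finrank ℝ V : ℝ) • Real.fourierChar (inner ℝ t₀ (x - s)) •
          (W (r • x - r • s) - W (r • x)) := by
      rw [hK, hK, smul_comm (Real.fourierChar (-inner ℝ s t₀)), smul_smul
        (Real.fourierChar (-inner ℝ s t₀)), ← AddChar.map_add_eq_mul, ← smul_sub,
        inner_sub_right, real_inner_comm s t₀, neg_add_eq_sub, smul_sub r]
      simp only [smul_sub]
    rw [this, enorm_smul, Real.enorm_of_nonneg (by positivity)]
    congr 1
    rw [← ofReal_norm, ← ofReal_norm, Circle.norm_smul]
  have hm : AEMeasurable (fun p : V × V => ‖q p.2 * (K (p.1 - p.2) -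
      Real.fourierChar (-inner ℝ p.2 t₀) • K p.1)‖ₑ) (volume.prod volume) := by
    refine (hq.1.comp_snd.mul (Continuous.aestronglyMeasurable ?_)).enorm
    refine (K.continuous.comp (by fun_prop)).sub ?_
    simp only [Circle.smul_def]
    refine Continuous.smul (continuous_subtype_val.comp (Real.continuous_fourierChar.comp ?_))
      (K.continuous.comp continuous_fst)
    fun_prop
  calc ∫⁻ x, ‖(K ⋆[mul ℂ ℂ] q) x - 𝓕 q t₀ * K x‖ₑ
      ≤ ∫⁻ x, ∫⁻ s, ‖q s * (K (x - s) - Real.fourierChar (-inner ℝ s t₀) • K x)‖ₑ :=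
        lintegral_mono fun x => by rw [hpt]; exact enorm_integral_le_lintegral_enorm _
    _ = ∫⁻ s, ∫⁻ x, ‖q s * (K (x - s) - Real.fourierChar (-inner ℝ s t₀) • K x)‖ₑ :=
        lintegral_lintegral_swap hm
    _ = ∫⁻ s, ‖q s‖ₑ * translModulus W (r • s) := by
        refine lintegral_congr fun s => ?_
        simp only [enorm_mul, hnorm]
        rw [lintegral_const_mul' _ _ enorm_ne_top,
          lintegral_pow_mul_comp_smul hr (fun x => ‖W (x - r • s) - W x‖ₑ)]
        rfl

/-- The kernels at frequency `0` form an approximate identity in `L¹`. -/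
theorem lintegral_convolution_sub_self_le {ψ : V → ℂ} (hψ : Integrable ψ) (W K : 𝓢(V, ℂ))
    {r : ℝ} (hr : 0 < r) (hint : ∫ x, K x = 1)
    (hK : ∀ x, ‖K x‖ₑ = ENNReal.ofReal (r ^ Module.finrank ℝ V) * ‖W (r • x)‖ₑ) :
    ∫⁻ x, ‖(K ⋆[mul ℂ ℂ] ψ) x - ψ x‖ₑ ≤ ∫⁻ s, ‖W s‖ₑ * translModulus ψ (r⁻¹ • s) := by
  have hpt : ∀ᵐ x, ‖(K ⋆[mul ℂ ℂ] ψ) x - ψ x‖ₑ ≤ ∫⁻ s, ‖K s * (ψ (x - s) - ψ x)‖ₑ := by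
    filter_upwards [K.integrable.ae_convolution_exists (ν := volume) (mul ℂ ℂ) hψ] with x hx
    have h1 : ψ x = ∫ s, K s * ψ x := by rw [integral_mul_const, hint, one_mul]
    rw [ConvolutionExistsAt] at hx
    simp only [mul_apply'] at hx
    have h2 : (K ⋆[mul ℂ ℂ] ψ) x - ψ x = ∫ s, K s * (ψ (x - s) - ψ x) := by
      conv_lhs => rw [convolution_def, h1]
      simp only [mul_apply']
      rw [← integral_sub hx (K.integrable.mul_const _)]
      simp only [mul_sub]
    rw [h2]
    exact enorm_integral_le_lintegral_enorm _
  have hm : AEMeasurable (fun p : V × V => ‖K p.2 * (ψ (p.1 - p.2) - ψ p.1)‖ₑ)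
      (volume.prod volume) :=
    (K.integrable.1.comp_snd.mul ((aestronglyMeasurable_comp_sub_prod hψ).sub hψ.1.comp_fst)).enorm
  calc ∫⁻ x, ‖(K ⋆[mul ℂ ℂ] ψ) x - ψ x‖ₑ
      ≤ ∫⁻ x, ∫⁻ s, ‖K s * (ψ (x - s) - ψ x)‖ₑ := lintegral_mono_ae hpt
    _ = ∫⁻ s, ∫⁻ x, ‖K s * (ψ (x - s) - ψ x)‖ₑ := lintegral_lintegral_swap hm
    _ = ∫⁻ s, ENNReal.ofReal (r ^ Module.finrank ℝ V) *
          (‖W (r • s)‖ₑ * translModulus ψ (r⁻¹ • r • s)) := by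
        refine lintegral_congr fun s => ?_
        simp only [enorm_mul]
        rw [lintegral_const_mul' _ _ enorm_ne_top, hK, inv_smul_smul₀ hr.ne', mul_assoc]
        rfl
    _ = _ := lintegral_pow_mul_comp_smul hr (fun s => ‖W s‖ₑ * translModulus ψ (r⁻¹ • s))

theorem tendsto_lintegral_mul_translModulus {ψ χ : V → ℂ} (hψ : Integrable ψ) (hχ : Integrable χ) :
    Tendsto (fun r : ℝ => ∫⁻ s, ‖χ s‖ₑ * translModulus ψ (r • s)) (𝓝 0) (𝓝 0) := by
  have h0 : Tendsto (fun r : ℝ => ∫⁻ s, ‖χ s‖ₑ * translModulus ψ (r • s)) (𝓝 0)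
      (𝓝 (∫⁻ _ : V, 0)) := by
    refine tendsto_lintegral_filter_of_dominated_convergence'
      (fun s => ‖χ s‖ₑ * (2 * ∫⁻ y, ‖ψ y‖ₑ)) (Eventually.of_forall fun r => ?_)
      (Eventually.of_forall fun r => Eventually.of_forall fun s => ?_) ?_
      (Eventually.of_forall fun s => ?_)
    · exact hχ.1.enorm.mul
        ((continuous_translModulus hψ).comp (continuous_const_smul r)).measurable.aemeasurable
    · gcongr
      exact translModulus_le hψ _
    · rw [lintegral_mul_const'' _ hχ.1.enorm]
      exact ENNReal.mul_ne_top hχ.2.ne (ENNReal.mul_ne_top (by simp) hψ.2.ne)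
    · have h1 : Tendsto (fun r : ℝ => translModulus ψ (r • s)) (𝓝 0) (𝓝 0) := by
        have hc : Continuous fun r : ℝ => translModulus ψ (r • s) :=
          (continuous_translModulus hψ).comp (by fun_prop)
        simpa [translModulus_zero] using hc.tendsto 0
      simpa using ENNReal.Tendsto.const_mul h1 (Or.inr enorm_ne_top)
  simpa using h0

end Wiener

/-! ### A quantitative form of Wiener's Tauberian theorem -/

section WienerTauberian

set_option linter.unusedSectionVars false

variable {V : Type*} [NormedAddCommGroup V] [InnerProductSpace ℝ V] [FiniteDimensional ℝ V]
  [MeasurableSpace V] [BorelSpace V]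

/-- `ψ` is dominated by `q` if `‖(σ - σ') * ψ‖₁ ≤ C ‖(σ - σ') * q‖₁` for all probability
measures `σ, σ'`, with a finite constant `C`. -/
def ConvDominated (q ψ : V → ℂ) : Prop :=
  ∃ C : ℝ≥0∞, C ≠ ∞ ∧ ∀ (σ σ' : Measure V) [IsProbabilityMeasure σ] [IsProbabilityMeasure σ'],
    convDiffNorm σ σ' ψ ≤ C * convDiffNorm σ σ' q

theorem ConvDominated.zero (q : V → ℂ) : ConvDominated q 0 := by
  refine ⟨0, by simp, fun σ σ' _ _ => ?_⟩
  simp [convDiffNorm, convDiff]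

theorem ConvDominated.add {q ψ χ : V → ℂ} (h1 : ConvDominated q ψ) (h2 : ConvDominated q χ)
    (hψ : Integrable ψ) (hχ : Integrable χ) : ConvDominated q (ψ + χ) := by
  obtain ⟨C, hC, h1⟩ := h1
  obtain ⟨D, hD, h2⟩ := h2
  refine ⟨C + D, by simp [hC, hD], fun σ σ' _ _ => ?_⟩
  rw [add_mul]
  exact (convDiffNorm_add_le σ σ' hψ hχ).trans (add_le_add (h1 σ σ') (h2 σ σ'))

theorem ConvDominated.sum {ι : Type*} {q : V → ℂ} (s : Finset ι) (φ : ι → 𝓢(V, ℂ))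
    (h : ∀ i ∈ s, ConvDominated q (φ i)) : ConvDominated q ⇑(∑ i ∈ s, φ i) := by
  classical
  induction s using Finset.induction_on with
  | empty => simpa using ConvDominated.zero q
  | insert a s ha ih =>
    rw [Finset.sum_insert ha]
    exact (h a (by simp)).add (ih fun i hi => h i (by simp [hi])) (φ a).integrable
      (∑ i ∈ s, φ i).integrable

theorem convDiffNorm_ne_top {ψ : V → ℂ} (hψ : Integrable ψ) (σ σ' : Measure V)
    [IsProbabilityMeasure σ] [IsProbabilityMeasure σ'] : convDiffNorm σ σ' ψ ≠ ∞ :=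
  ((convDiffNorm_le σ σ' hψ).trans_lt
    (ENNReal.mul_lt_top (by simp) hψ.2)).ne

theorem schwartzMap_eq_of_fourier_eq {f g : 𝓢(V, ℂ)} (h : 𝓕 f = 𝓕 g) : f = g := by
  have := congrArg (fun u : 𝓢(V, ℂ) => 𝓕⁻ u) h
  simpa using this

/-- The local step of Wiener's theorem. If the spectrum of `φ` lies close to a point `t₀` where `q̂`
does not vanish, then `q̂(t₀) φ = q * φ - φ * k` with `‖k‖₁ ≤ |q̂(t₀)| / 2`. The second term can be
absorbed, because only the finite quantity `‖(σ - σ') * φ‖₁` is to be bounded. -/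
theorem exists_forall_convDominated_of_spectrum_subset {q : V → ℂ} (hq : Integrable q) (t₀ : V)
    (h0 : 𝓕 q t₀ ≠ 0) : ∃ r > 0, ∀ φ : 𝓢(V, ℂ), (∀ t, 𝓕 φ t ≠ 0 → dist t t₀ ≤ r) →
      ConvDominated q φ := by
  obtain ⟨W, hW⟩ := exists_bandLimited_kernels (V := V)
  set c := 𝓕 q t₀ with hc
  have hc0 : ‖c‖ₑ ≠ 0 := by simpa using h0
  have hsmall : ∀ᶠ r : ℝ in 𝓝 0, ∫⁻ s, ‖q s‖ₑ * translModulus W (r • s) < ‖c‖ₑ / 2 :=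
    (tendsto_lintegral_mul_translModulus W.integrable hq).eventually_lt_const
      (ENNReal.half_pos hc0)
  obtain ⟨r, hr, hrpos⟩ : ∃ r : ℝ, ∫⁻ s, ‖q s‖ₑ * translModulus W (r • s) < ‖c‖ₑ / 2 ∧ 0 < r :=
    ((hsmall.filter_mono nhdsWithin_le_nhds).and (self_mem_nhdsWithin (s := Set.Ioi 0))).exists
  obtain ⟨K, hK, hK1, -⟩ := hW r hrpos t₀
  refine ⟨r, hrpos, fun φ hφ => ?_⟩
  -- the kernel `K` reproduces `φ`
  have hrep : φ ⋆[mul ℂ ℂ] K = φ := by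
    have : SchwartzMap.convolution (mul ℂ ℂ) φ K = φ := by
      have h : 𝓕 (SchwartzMap.convolution (mul ℂ ℂ) φ K) = 𝓕 φ := by
        rw [SchwartzMap.fourier_convolution]
        ext t
        rw [SchwartzMap.pairing_apply_apply]
        by_cases ht : 𝓕 φ t = 0
        · simp [ht]
        · simp [hK1 t (hφ t ht)]
      exact schwartzMap_eq_of_fourier_eq h
    ext x
    rw [← SchwartzMap.convolution_apply, this]
  let k : V → ℂ := fun x => (K ⋆[mul ℂ ℂ] q) x - c * K x
  have hKq : Integrable (K ⋆[mul ℂ ℂ] q) := K.integrable.integrable_convolution (mul ℂ ℂ) hq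
  have hk : Integrable k := hKq.sub (K.integrable.const_mul c)
  have hkle : ∫⁻ x, ‖k x‖ₑ ≤ ‖c‖ₑ / 2 :=
    (lintegral_kernel_convolution_sub_le hq W K hrpos t₀ hK).trans hr.le
  have hφk : Integrable (φ ⋆[mul ℂ ℂ] k) := φ.integrable.integrable_convolution (mul ℂ ℂ) hk
  have hqφ : Integrable (q ⋆[mul ℂ ℂ] φ) := hq.integrable_convolution (mul ℂ ℂ) φ.integrable
  have heq : (q ⋆[mul ℂ ℂ] φ) + (fun x => (-1) * (φ ⋆[mul ℂ ℂ] k) x)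
      =ᵐ[volume] fun x => c * φ x := by
    filter_upwards [φ.integrable.ae_convolution_exists (ν := volume) (mul ℂ ℂ) hKq,
      φ.integrable.ae_convolution_exists (ν := volume) (mul ℂ ℂ) K.integrable,
      φ.integrable.norm.ae_convolution_exists (ν := volume) (mul ℝ ℝ)
        (K.integrable.norm.integrable_convolution (mul ℝ ℝ) hq.norm)] with x h1 h2 h3
    have hassoc : ((φ ⋆[mul ℂ ℂ] K) ⋆[mul ℂ ℂ] q) x = (φ ⋆[mul ℂ ℂ] K ⋆[mul ℂ ℂ] q) x :=
      convolution_assoc (mul ℂ ℂ) (mul ℂ ℂ) (mul ℂ ℂ) (mul ℂ ℂ) (by simp [mul_assoc])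
        φ.integrable.1 K.integrable.1 hq.1
        (φ.integrable.ae_convolution_exists (ν := volume) (mul ℂ ℂ) K.integrable)
        (K.integrable.norm.ae_convolution_exists (ν := volume) (mul ℝ ℝ) hq.norm) h3
    rw [hrep] at hassoc
    have hk' : (φ ⋆[mul ℂ ℂ] k) x = (φ ⋆[mul ℂ ℂ] K ⋆[mul ℂ ℂ] q) x - c * φ x := by
      have hx : φ x = (φ ⋆[mul ℂ ℂ] K) x := by rw [hrep]
      rw [hx]
      simp only [ConvolutionExistsAt, mul_apply'] at h1 h2
      simp only [convolution_def (f := φ), mul_apply']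
      rw [← integral_const_mul, ← integral_sub h1 (h2.const_mul c)]
      congr 1 with t
      simp only [k]
      ring
    have hcomm : (q ⋆[mul ℂ ℂ] φ) x = (φ ⋆[mul ℂ ℂ] q) x := by
      rw [convolution_mul, convolution_mul_swap]
      simp only [mul_comm]
    simp only [Pi.add_apply]
    rw [hk', hcomm, hassoc]
    ring
  refine ⟨2 / ‖c‖ₑ * ∫⁻ x, ‖φ x‖ₑ, ENNReal.mul_ne_top (ENNReal.div_ne_top (by simp) hc0)
    φ.integrable.2.ne, fun σ σ' _ _ => ?_⟩
  have hN : ‖c‖ₑ * convDiffNorm σ σ' φ ≤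
      convDiffNorm σ σ' q * (∫⁻ x, ‖φ x‖ₑ) + convDiffNorm σ σ' φ * (‖c‖ₑ / 2) := by
    rw [← convDiffNorm_const_mul, ← convDiffNorm_congr_ae σ σ' (hqφ.add (hφk.const_mul (-1))) heq]
    refine (convDiffNorm_add_le σ σ' hqφ (hφk.const_mul (-1))).trans (add_le_add ?_ ?_)
    · exact convDiffNorm_convolution_le σ σ' hq φ.integrable
    · rw [convDiffNorm_const_mul]
      simp only [enorm_neg, enorm_one, one_mul]
      exact (convDiffNorm_convolution_le σ σ' φ.integrable hk).trans (by gcongr)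
  -- absorption: a finite quantity is subtracted from both sides
  have hfin := convDiffNorm_ne_top φ.integrable σ σ'
  have hhalf : ‖c‖ₑ / 2 * convDiffNorm σ σ' φ ≤ convDiffNorm σ σ' q * ∫⁻ x, ‖φ x‖ₑ := by
    have h2 : ‖c‖ₑ * convDiffNorm σ σ' φ = ‖c‖ₑ / 2 * convDiffNorm σ σ' φ +
        convDiffNorm σ σ' φ * (‖c‖ₑ / 2) := by
      rw [mul_comm (convDiffNorm σ σ' φ), ← add_mul, ENNReal.add_halves]
    rw [h2] at hN
    exact ENNReal.le_of_add_le_add_right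
      (ENNReal.mul_ne_top hfin (ENNReal.div_ne_top enorm_ne_top (by simp))) hN
  have hc2 : 2 / ‖c‖ₑ * (‖c‖ₑ / 2) = 1 := by
    rw [← ENNReal.inv_div (by simp) (by simp), mul_comm]
    exact ENNReal.mul_inv_cancel (ENNReal.div_ne_zero.2 ⟨hc0, by simp⟩)
      (ENNReal.div_ne_top enorm_ne_top (by simp))
  calc convDiffNorm σ σ' φ = 2 / ‖c‖ₑ * (‖c‖ₑ / 2 * convDiffNorm σ σ' φ) := by
        rw [← mul_assoc, hc2, one_mul]
    _ ≤ 2 / ‖c‖ₑ * (convDiffNorm σ σ' q * ∫⁻ x, ‖φ x‖ₑ) := by gcongr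
    _ = _ := by ring

/-- Every Schwartz function with compact spectrum is dominated by `q`, if `q̂` vanishes nowhere: a
smooth partition of unity on the spectrum reduces this to the local step. -/
theorem convDominated_of_hasCompactSupport_fourier {q : V → ℂ} (hq : Integrable q)
    (h0 : ∀ t, 𝓕 q t ≠ 0) (φ : 𝓢(V, ℂ)) (hφ : HasCompactSupport ⇑(𝓕 φ : 𝓢(V, ℂ))) :
    ConvDominated q φ := by
  choose r hr hloc using fun t => exists_forall_convDominated_of_spectrum_subset hq t (h0 t)
  obtain ⟨s, -, hs⟩ := hφ.isCompact.elim_nhds_subcover (fun t => Metric.ball t (r t))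
    fun t _ => Metric.ball_mem_nhds t (hr t)
  obtain ⟨ρ, hρ⟩ := SmoothPartitionOfUnity.exists_isSubordinate (modelWithCornersSelf ℝ V)
    (isClosed_tsupport ⇑(𝓕 φ : 𝓢(V, ℂ))) (fun t : s => Metric.ball (t : V) (r t))
    (fun t => Metric.isOpen_ball) (by simpa [Set.iUnion_subtype] using hs)
  have hcs : ∀ i, HasCompactSupport fun t => ((ρ i t : ℝ) : ℂ) * 𝓕 φ t := fun i =>
    hφ.mul_left
  have hsm : ∀ i, ContDiff ℝ (⊤ : ℕ∞) fun t => ((ρ i t : ℝ) : ℂ) * 𝓕 φ t := fun i => by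
    have h1 : ContDiff ℝ (⊤ : ℕ∞) (ρ i) := (ρ i).contMDiff.contDiff
    exact (Complex.ofRealCLM.contDiff.comp h1).mul ((𝓕 φ : 𝓢(V, ℂ)).smooth ⊤)
  let φi : s → 𝓢(V, ℂ) := fun i => 𝓕⁻ ((hcs i).toSchwartzMap (hsm i))
  have hF : ∀ i t, 𝓕 (φi i) t = ((ρ i t : ℝ) : ℂ) * 𝓕 φ t := fun i t => by
    simp only [φi, FourierTransform.fourier_fourierInv_eq]
    rfl
  have hsum : φ = ∑ i : s, φi i := by
    refine schwartzMap_eq_of_fourier_eq (SchwartzMap.ext fun t => ?_)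
    have hlin : 𝓕 (∑ i : s, φi i) = ∑ i : s, 𝓕 (φi i) :=
      map_sum (FourierTransform.fourierCLM ℂ 𝓢(V, ℂ)) φi Finset.univ
    rw [hlin, _root_.sum_apply]
    simp only [hF]
    rw [← Finset.sum_mul]
    by_cases ht : t ∈ tsupport ⇑(𝓕 φ : 𝓢(V, ℂ))
    · have h1 := ρ.sum_eq_one ht
      rw [finsum_eq_sum_of_fintype] at h1
      rw [← Complex.ofReal_sum, h1]
      simp
    · rw [image_eq_zero_of_notMem_tsupport ht]
      simp
  rw [hsum]
  refine ConvDominated.sum _ _ fun i _ => hloc i (φi i) fun t ht => ?_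
  rw [hF] at ht
  have h1 : ρ i t ≠ 0 := fun h => ht (by simp [h])
  exact (Metric.mem_ball.1 (hρ i (subset_tsupport _ h1))).le

/-- **Wiener's Tauberian theorem** in quantitative form: if `q̂` vanishes nowhere, then for each
`ψ ∈ L¹`, the norm `‖(σ - σ') * ψ‖₁` is controlled by `‖(σ - σ') * q‖₁`, uniformly over all
probability measures `σ, σ'`. -/
theorem exists_forall_convDiffNorm_le {q : V → ℂ} (hq : Integrable q) (h0 : ∀ t, 𝓕 q t ≠ 0)
    {ψ : V → ℂ} (hψ : Integrable ψ) {ε : ℝ≥0∞} (hε : ε ≠ 0) :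
    ∃ C : ℝ≥0∞, C ≠ ∞ ∧ ∀ (σ σ' : Measure V) [IsProbabilityMeasure σ] [IsProbabilityMeasure σ'],
      convDiffNorm σ σ' ψ ≤ ε + C * convDiffNorm σ σ' q := by
  obtain ⟨W, hW⟩ := exists_bandLimited_kernels (V := V)
  have hsmall : ∀ᶠ r : ℝ in 𝓝 0, ∫⁻ s, ‖W s‖ₑ * translModulus ψ (r • s) < ε / 2 :=
    (tendsto_lintegral_mul_translModulus hψ W.integrable).eventually_lt_const (ENNReal.half_pos hε)
  obtain ⟨r, hr, hrpos⟩ : ∃ r : ℝ, ∫⁻ s, ‖W s‖ₑ * translModulus ψ (r • s) < ε / 2 ∧ 0 < r :=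
    ((hsmall.filter_mono nhdsWithin_le_nhds).and (self_mem_nhdsWithin (s := Set.Ioi 0))).exists
  obtain ⟨K, hK, hK1, hKc⟩ := hW r⁻¹ (inv_pos.2 hrpos) 0
  have hKint : ∫ x, K x = 1 := by
    have := hK1 0 (by simpa using hrpos.le)
    rw [SchwartzMap.fourier_coe, Real.fourier_eq] at this
    simpa using this
  have hKn : ∀ x, ‖K x‖ₑ = ENNReal.ofReal (r⁻¹ ^ Module.finrank ℝ V) * ‖W (r⁻¹ • x)‖ₑ := fun x => by
    rw [hK, enorm_smul, Real.enorm_of_nonneg (by positivity)]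
    congr 1
    rw [← ofReal_norm, ← ofReal_norm, Circle.norm_smul]
  obtain ⟨C, hC, hCN⟩ := convDominated_of_hasCompactSupport_fourier hq h0 K hKc
  have happ := lintegral_convolution_sub_self_le hψ W K (inv_pos.2 hrpos) hKint hKn
  rw [inv_inv] at happ
  have hKψ : Integrable (K ⋆[mul ℂ ℂ] ψ) := K.integrable.integrable_convolution (mul ℂ ℂ) hψ
  refine ⟨C * ∫⁻ x, ‖ψ x‖ₑ, ENNReal.mul_ne_top hC hψ.2.ne, fun σ σ' _ _ => ?_⟩
  have hdec : ψ = (ψ - (K ⋆[mul ℂ ℂ] ψ)) + (K ⋆[mul ℂ ℂ] ψ) := by simp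
  calc convDiffNorm σ σ' ψ
      ≤ convDiffNorm σ σ' (ψ - (K ⋆[mul ℂ ℂ] ψ)) + convDiffNorm σ σ' (K ⋆[mul ℂ ℂ] ψ) := by
        conv_lhs => rw [hdec]
        exact convDiffNorm_add_le σ σ' (hψ.sub hKψ) hKψ
    _ ≤ 2 * (ε / 2) + convDiffNorm σ σ' K * ∫⁻ x, ‖ψ x‖ₑ := by
        refine add_le_add ((convDiffNorm_le σ σ' (hψ.sub hKψ)).trans ?_)
          (convDiffNorm_convolution_le σ σ' K.integrable hψ)
        gcongr
        refine le_trans (le_of_eq (lintegral_congr fun x => ?_)) (happ.trans hr.le)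
        rw [Pi.sub_apply, ← enorm_neg, neg_sub]
    _ ≤ ε + C * convDiffNorm σ σ' q * ∫⁻ x, ‖ψ x‖ₑ := by
        rw [ENNReal.mul_div_cancel (by simp) (by simp)]
        gcongr
        exact hCN σ σ'
    _ = _ := by ring

end WienerTauberian

/-! ### Unnormalized updates over the bounded-Lipschitz ball -/

section Observation

set_option linter.unusedSectionVars false

variable {V : Type*} [NormedAddCommGroup V] [InnerProductSpace ℝ V] [FiniteDimensional ℝ V]
  [MeasurableSpace V] [BorelSpace V]
  {E : Type*} [MetricSpace E] [MeasurableSpace E] [BorelSpace E]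

theorem lintegral_lintegral_comp_sub (κ : Measure E) [IsProbabilityMeasure κ] {h : E → V}
    (hh : Measurable h) {w : V → ℝ≥0∞} (hw : Measurable w) :
    ∫⁻ y, ∫⁻ x, w (y - h x) ∂κ = ∫⁻ y, w y := by
  rw [lintegral_lintegral_swap
    (f := fun y x => w (y - h x)) (by fun_prop)]
  simp_rw [lintegral_sub_right_eq_self w]
  simp

theorem convDiff_map_ofReal (κ κ' : Measure E) [IsProbabilityMeasure κ] [IsProbabilityMeasure κ']
    {h : E → V} (hh : Measurable h) {w : V → ℝ} (hw : Measurable w) (y : V) :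
    convDiff (κ.map h) (κ'.map h) (fun y => (w y : ℂ)) y =
      (((∫ x, w (y - h x) ∂κ) - ∫ x, w (y - h x) ∂κ' : ℝ) : ℂ) := by
  have hm : Measurable fun u => (w (y - u) : ℂ) := by fun_prop
  rw [convDiff, integral_map hh.aemeasurable hm.aestronglyMeasurable,
    integral_map hh.aemeasurable hm.aestronglyMeasurable, integral_complex_ofReal,
    integral_complex_ofReal,
    Complex.ofReal_sub]

theorem ae_integrable_comp_sub_map (κ : Measure E) [IsProbabilityMeasure κ]
    {h : E → V} (hh : Measurable h) {w : V → ℝ} (hw : Measurable w) (hwi : Integrable w) :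
    ∀ᵐ y, Integrable (fun x => w (y - h x)) κ := by
  have h1 : ∫⁻ y, ∫⁻ x, ‖w (y - h x)‖ₑ ∂κ ≠ ∞ := by
    rw [lintegral_lintegral_comp_sub κ hh (w := fun y => ‖w y‖ₑ) (by fun_prop)]
    exact hwi.2.ne
  have hm : Measurable fun y => ∫⁻ x, ‖w (y - h x)‖ₑ ∂κ :=
    Measurable.lintegral_prod_right' (f := fun p : V × E => ‖w (p.1 - h p.2)‖ₑ) (by fun_prop)
  filter_upwards [ae_lt_top hm h1] with y hy
  exact ⟨Measurable.aestronglyMeasurable (by fun_prop), hy⟩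

/-- If the values `h x` determine `x` uniformly continuously, the unnormalized updates
`∫ f(x) q(y - h x) κ(dx)` of two laws `κ, κ'` are close in `L¹(dy)`, uniformly over the
bounded-Lipschitz ball, once the laws of the observation `h(x) + ξ` are close. The supremum over `f`
stands inside the `L¹` norm: `q` is cut into finitely many pieces supported in small cells, on each
of which `f = f ∘ g ∘ h` is nearly a constant, and Wiener's theorem applies to each piece. -/
theorem exists_bound_unnormalized_update {h : E → V} (hh : Measurable h) {g : V → E}
    (hg : UniformContinuous g) (hgh : ∀ x, g (h x) = x) {q : V → ℝ} (hq : Measurable q)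
    (hq0 : ∀ y, 0 ≤ q y) (hq1 : ∫⁻ y, ENNReal.ofReal (q y) = 1)
    (hqF : ∀ t, 𝓕 (fun y => (q y : ℂ)) t ≠ 0) {ε : ℝ≥0∞} (hε : ε ≠ 0) :
    ∃ C : ℝ≥0∞, C ≠ ∞ ∧ ∀ (κ κ' : Measure E) [IsProbabilityMeasure κ] [IsProbabilityMeasure κ'],
      ∃ G : V → ℝ≥0∞,
        ∫⁻ y, G y ≤ ε + C * convDiffNorm (κ.map h) (κ'.map h) (fun y => (q y : ℂ)) ∧
        ∀ᵐ y, ∀ f : E → ℝ, (∀ x, |f x| ≤ 1) → LipschitzWith 1 f →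
          ‖(∫ x, f x * q (y - h x) ∂κ) - ∫ x, f x * q (y - h x) ∂κ'‖ₑ ≤ G y := by
  have hqe : ∀ y, ‖q y‖ₑ = ENNReal.ofReal (q y) := fun y => Real.enorm_of_nonneg (hq0 y)
  have hqi : Integrable q := by
    refine ⟨hq.aestronglyMeasurable, ?_⟩
    simp only [HasFiniteIntegral, hqe, hq1]
    simp
  -- the error is made of `η` from the `δ i` and `2 η` from each of `κ`, `κ'`, hence `5 η` in all
  obtain ⟨η, hη0, hηε⟩ := ENNReal.lt_iff_exists_nnreal_btwn.1
    (ENNReal.div_pos hε (show (5 : ℝ≥0∞) ≠ ∞ by simp))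
  have hη0' : 0 < η := by exact_mod_cast hη0
  obtain ⟨r, hr, hgr⟩ := Metric.uniformContinuous_iff.1 hg η (by exact_mod_cast hη0')
  -- a countable partition into cells of radius `r`
  let c : ℕ → V := TopologicalSpace.denseSeq V
  let Q : ℕ → Set V := disjointed fun i => Metric.ball (c i) r
  have hQm : ∀ i, MeasurableSet (Q i) :=
    MeasurableSet.disjointed fun i => measurableSet_ball
  have hQd : Pairwise (Function.onFun Disjoint Q) := disjoint_disjointed _
  have hQU : ⋃ i, Q i = Set.univ := by
    rw [iUnion_disjointed]
    refine Set.eq_univ_of_forall fun x => ?_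
    obtain ⟨_, hi, ⟨i, rfl⟩⟩ := Metric.dense_iff.1 (TopologicalSpace.denseRange_denseSeq V) x r hr
    exact Set.mem_iUnion.2 ⟨i, by rw [Metric.mem_ball, dist_comm]; exact hi⟩
  have hQb : ∀ i, Q i ⊆ Metric.ball (c i) r := fun i => disjointed_subset _ i
  -- all but finitely many cells carry little mass
  obtain ⟨N, hN⟩ : ∃ N, (volume.withDensity fun y => ENNReal.ofReal (q y)) (⋃ i ≥ N, Q i) < η := by
    have : IsFiniteMeasure (volume.withDensity fun y => ENNReal.ofReal (q y)) :=
      isFiniteMeasure_withDensity (by simp [hq1])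
    have := tendsto_measure_biUnion_Ici_zero_of_pairwise_disjoint
      (μ := volume.withDensity fun y => ENNReal.ofReal (q y))
      (fun i => (hQm i).nullMeasurableSet) hQd
    exact (this.eventually_lt_const hη0).exists
  let R : Set V := ⋃ i ≥ N, Q i
  have hRm : MeasurableSet R := .iUnion fun i => .iUnion fun _ => hQm i
  let ψ : ℕ → V → ℝ := fun i => (Q i).indicator q
  have hψm : ∀ i, Measurable (ψ i) := fun i => hq.indicator (hQm i)
  have hψi : ∀ i, Integrable (ψ i) := fun i => hqi.indicator (hQm i)
  obtain ⟨δ, hδ0, hδ⟩ := ENNReal.exists_pos_sum_of_countable' hη0.ne' ℕ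
  choose C hC hCN using fun i => exists_forall_convDiffNorm_le hqi.ofReal hqF
    (ψ := fun y => (ψ i y : ℂ)) (hψi i).ofReal (hδ0 i).ne'
  -- `w (y - h x)` bounds the error at `x` of replacing `f` by its values at the centres of the
  -- cells `Q i` with `i < N` and dropping the other cells
  let w : V → ℝ≥0∞ := fun y => η * ‖q y‖ₑ + ‖R.indicator q y‖ₑ
  have hwm : Measurable w := by
    have := hq.indicator hRm
    fun_prop
  have hwint : ∫⁻ y, w y ≤ 2 * η := by
    have h1 : ∫⁻ y, ‖R.indicator q y‖ₑ ≤ η := by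
      have : ∀ y, ‖R.indicator q y‖ₑ = R.indicator (fun y => ENNReal.ofReal (q y)) y := fun y => by
        simp only [enorm_indicator_eq_indicator_enorm, hqe]
      simp only [this]
      rw [lintegral_indicator hRm, ← withDensity_apply _ hRm]
      exact hN.le
    rw [lintegral_add_left (by fun_prop), lintegral_const_mul _ (by fun_prop)]
    simp only [hqe, hq1, mul_one, two_mul]
    gcongr
  refine ⟨∑ i ∈ Finset.range N, C i, ENNReal.sum_ne_top.2 fun i _ => hC i, fun κ κ' _ _ => ?_⟩
  have hκ := Measure.isProbabilityMeasure_map (μ := κ) hh.aemeasurable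
  have hκ' := Measure.isProbabilityMeasure_map (μ := κ') hh.aemeasurable
  let D : ℕ → V → ℝ := fun i y => (∫ x, ψ i (y - h x) ∂κ) - ∫ x, ψ i (y - h x) ∂κ'
  have hDN : ∀ i, ∫⁻ y, ‖D i y‖ₑ ≤
      δ i + C i * convDiffNorm (κ.map h) (κ'.map h) (fun y => (q y : ℂ)) := fun i => by
    refine le_trans (le_of_eq ?_) (hCN i (κ.map h) (κ'.map h))
    rw [convDiffNorm]
    refine lintegral_congr fun y => ?_
    rw [convDiff_map_ofReal κ κ' hh (hψm i), ← ofReal_norm, ← ofReal_norm, Complex.norm_real]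
  have hmeas : ∀ (κ : Measure E) [IsProbabilityMeasure κ] (i : ℕ),
      Measurable fun y => ∫ x, ψ i (y - h x) ∂κ := fun κ _ i => by
    have : StronglyMeasurable (fun p : V × E => ψ i (p.1 - h p.2)) :=
      (Measurable.stronglyMeasurable (by have := hψm i; fun_prop))
    exact this.integral_prod_right'.measurable
  have hDm : ∀ i, Measurable (D i) := fun i => (hmeas κ i).sub (hmeas κ' i)
  have hWm : ∀ (κ : Measure E) [IsProbabilityMeasure κ], Measurable fun y => ∫⁻ x, w (y - h x) ∂κ :=
    fun κ _ => Measurable.lintegral_prod_right' (f := fun p : V × E => w (p.1 - h p.2)) (by fun_prop)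
  refine ⟨fun y => ((∑ i ∈ Finset.range N, ‖D i y‖ₑ) + ∫⁻ x, w (y - h x) ∂κ) +
    ∫⁻ x, w (y - h x) ∂κ', ?_, ?_⟩
  · rw [lintegral_add_right _ (hWm κ'), lintegral_add_right _ (hWm κ),
      lintegral_finsetSum _ (fun i _ => (hDm i).enorm), lintegral_lintegral_comp_sub κ hh hwm,
      lintegral_lintegral_comp_sub κ' hh hwm]
    set M := convDiffNorm (κ.map h) (κ'.map h) (fun y => (q y : ℂ))
    calc (∑ i ∈ Finset.range N, ∫⁻ y, ‖D i y‖ₑ) + (∫⁻ y, w y) + ∫⁻ y, w y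
        ≤ (∑ i ∈ Finset.range N, (δ i + C i * M)) + 2 * η + 2 * η := by
          gcongr with i
          exact hDN i
      _ = (∑ i ∈ Finset.range N, δ i) + (∑ i ∈ Finset.range N, C i) * M + 2 * η + 2 * η := by
          rw [Finset.sum_add_distrib, Finset.sum_mul]
      _ ≤ η + (∑ i ∈ Finset.range N, C i) * M + 2 * η + 2 * η := by
          gcongr
          exact (ENNReal.sum_le_tsum _).trans hδ.le
      _ = 5 * η + (∑ i ∈ Finset.range N, C i) * M := by ring
      _ ≤ 5 * (ε / 5) + (∑ i ∈ Finset.range N, C i) * M := by gcongr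
      _ = ε + (∑ i ∈ Finset.range N, C i) * M := by
          rw [ENNReal.mul_div_cancel (by simp) (by simp)]
  · filter_upwards [ae_integrable_comp_sub_map κ hh hq hqi, ae_integrable_comp_sub_map κ' hh hq hqi,
      ae_all_iff.2 fun i => ae_integrable_comp_sub_map κ hh (hψm i) (hψi i),
      ae_all_iff.2 fun i => ae_integrable_comp_sub_map κ' hh (hψm i) (hψi i)]
      with y hy hy' hyi hyi' f hf1 hfL
    let a : ℕ → ℝ := fun i => f (g (y - c i))
    let rem : E → ℝ := fun x => f x * q (y - h x) - ∑ i ∈ Finset.range N, a i * ψ i (y - h x)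
    have hrem : ∀ x, ‖rem x‖ₑ ≤ w (y - h x) := fun x => by
      obtain ⟨i, hi⟩ := Set.mem_iUnion.1 (hQU.symm ▸ Set.mem_univ (y - h x))
      have hother : ∀ j, j ≠ i → ψ j (y - h x) = 0 := fun j hj =>
        Set.indicator_of_notMem (fun hm => Set.disjoint_left.1 (hQd hj) hm hi) _
      have hself : ψ i (y - h x) = q (y - h x) := Set.indicator_of_mem hi _
      rcases lt_or_ge i N with hiN | hiN
      · have hs : ∑ j ∈ Finset.range N, a j * ψ j (y - h x) = a i * q (y - h x) := by
          rw [Finset.sum_eq_single i, hself]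
          · intro j _ hj
            rw [hother j hj, mul_zero]
          · intro hi'
            simp [hiN] at hi'
        have hd : dist (h x) (y - c i) < r := by
          have := hQb i hi
          rw [Metric.mem_ball, dist_eq_norm] at this
          rwa [dist_eq_norm, show h x - (y - c i) = -(y - h x - c i) by abel, norm_neg]
        have hfa : |f x - a i| ≤ η := by
          have h1 := hfL.dist_le_mul x (g (y - c i))
          have h2 := hgr hd
          rw [hgh] at h2
          rw [Real.dist_eq] at h1
          simp only [NNReal.coe_one, one_mul] at h1
          exact h1.trans h2.le
        have hle : ‖rem x‖ₑ ≤ η * ‖q (y - h x)‖ₑ := by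
          simp only [rem, hs, ← sub_mul, enorm_mul]
          gcongr
          rw [Real.enorm_eq_ofReal_abs]
          exact ENNReal.ofReal_le_of_le_toReal (by simpa using hfa)
        exact hle.trans le_self_add
      · have hs : ∑ j ∈ Finset.range N, a j * ψ j (y - h x) = 0 :=
          Finset.sum_eq_zero fun j hj => by
            rw [hother j (by have := Finset.mem_range.1 hj; omega), mul_zero]
        have hR : y - h x ∈ R := Set.mem_iUnion₂.2 ⟨i, hiN, hi⟩
        have hle : ‖rem x‖ₑ ≤ ‖R.indicator q (y - h x)‖ₑ := by
          simp only [rem, hs, sub_zero, enorm_mul, Set.indicator_of_mem hR]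
          refine mul_le_of_le_one_left zero_le ?_
          rw [Real.enorm_eq_ofReal_abs]
          exact ENNReal.ofReal_le_one.2 (hf1 x)
        exact hle.trans le_add_self
    have hfq : ∀ {κ : Measure E}, Integrable (fun x => q (y - h x)) κ →
        Integrable (fun x => f x * q (y - h x)) κ := fun hi =>
      hi.bdd_mul (c := 1) hfL.continuous.measurable.aestronglyMeasurable
        (Eventually.of_forall fun x => hf1 x)
    have hsplit : ∀ {κ : Measure E}, Integrable (fun x => q (y - h x)) κ →
        (∀ i, Integrable (fun x => ψ i (y - h x)) κ) →
        ∫ x, f x * q (y - h x) ∂κ =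
          (∑ i ∈ Finset.range N, a i * ∫ x, ψ i (y - h x) ∂κ) + ∫ x, rem x ∂κ := fun hi hii => by
      have hsumi := integrable_finsetSum (Finset.range N)
        (f := fun i x => a i * ψ i (y - h x)) fun i _ => (hii i).const_mul (a i)
      simp only [rem]
      rw [integral_sub (hfq hi) hsumi, integral_finsetSum _ fun i _ => (hii i).const_mul (a i)]
      simp only [integral_const_mul]
      ring
    have hdiff : (∫ x, f x * q (y - h x) ∂κ) - ∫ x, f x * q (y - h x) ∂κ' =
        (∑ i ∈ Finset.range N, a i * D i y) + (∫ x, rem x ∂κ) + -∫ x, rem x ∂κ' := by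
      rw [hsplit hy hyi, hsplit hy' hyi']
      simp only [D, mul_sub, Finset.sum_sub_distrib]
      ring
    rw [hdiff]
    refine (enorm_add_le _ _).trans (add_le_add ((enorm_add_le _ _).trans (add_le_add ?_ ?_)) ?_)
    · refine (enorm_sum_le _ _).trans (Finset.sum_le_sum fun i _ => ?_)
      rw [enorm_mul]
      refine mul_le_of_le_one_left zero_le ?_
      rw [Real.enorm_eq_ofReal_abs]
      exact ENNReal.ofReal_le_one.2 (hf1 _)
    · exact (enorm_integral_le_lintegral_enorm _).trans (lintegral_mono hrem)
    · rw [enorm_neg]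
      exact (enorm_integral_le_lintegral_enorm _).trans (lintegral_mono hrem)

end Observation

/-! ### The bounded-Lipschitz distance -/

section BoundedLipschitz

set_option linter.unusedSectionVars false

variable {E : Type*} [MetricSpace E] [MeasurableSpace E] [BorelSpace E]

theorem abs_integral_le_one {ρ : Measure E} [IsProbabilityMeasure ρ] {f : E → ℝ}
    (hf : ∀ x, |f x| ≤ 1) : |∫ x, f x ∂ρ| ≤ 1 := by
  have := norm_integral_le_of_norm_le_const (μ := ρ) (f := f) (C := 1)
    (Eventually.of_forall fun x => hf x)
  simpa using this

theorem bddAbove_blDist (ρ ρ' : Measure E) [IsProbabilityMeasure ρ] [IsProbabilityMeasure ρ'] :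
    BddAbove (Set.range fun f : {f : E → ℝ // (∀ x, |f x| ≤ 1) ∧ LipschitzWith 1 f} =>
      |(∫ x, f.1 x ∂ρ) - ∫ x, f.1 x ∂ρ'|) := by
  refine ⟨2, ?_⟩
  rintro _ ⟨f, rfl⟩
  have h1 := abs_integral_le_one (ρ := ρ) f.2.1
  have h2 := abs_integral_le_one (ρ := ρ') f.2.1
  exact (abs_sub _ _).trans (by linarith)

instance : Nonempty {f : E → ℝ // (∀ x, |f x| ≤ 1) ∧ LipschitzWith 1 f} :=
  ⟨⟨fun _ => 0, by simp, LipschitzWith.const' 0⟩⟩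

theorem blDist_nonneg (ρ ρ' : Measure E) : 0 ≤ blDist ρ ρ' :=
  Real.iSup_nonneg fun _ => abs_nonneg _

theorem blDist_le {ρ ρ' : Measure E} {c : ℝ} (h : ∀ f : E → ℝ, (∀ x, |f x| ≤ 1) →
    LipschitzWith 1 f → |(∫ x, f x ∂ρ) - ∫ x, f x ∂ρ'| ≤ c) : blDist ρ ρ' ≤ c :=
  ciSup_le fun f => h f.1 f.2.1 f.2.2

theorem blDist_le_two (ρ ρ' : Measure E) [IsProbabilityMeasure ρ] [IsProbabilityMeasure ρ'] :
    blDist ρ ρ' ≤ 2 :=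
  blDist_le fun f hf _ => by
    have h1 := abs_integral_le_one (ρ := ρ) hf
    have h2 := abs_integral_le_one (ρ := ρ') hf
    exact (abs_sub _ _).trans (by linarith)

/-- Countably many functions suffice in the supremum that defines `blDist`: the bounded-Lipschitz
ball of a separable space is separable for pointwise convergence. -/
theorem exists_countable_blDist [SecondCountableTopology E] [Nonempty E] : ∃ F : ℕ → E → ℝ,
    (∀ n, (∀ x, |F n x| ≤ 1) ∧ LipschitzWith 1 (F n)) ∧
    ∀ (ρ ρ' : Measure E) [IsProbabilityMeasure ρ] [IsProbabilityMeasure ρ'],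
      blDist ρ ρ' = ⨆ n, |(∫ x, F n x ∂ρ) - ∫ x, F n x ∂ρ'| := by
  let B := {f : E → ℝ // (∀ x, |f x| ≤ 1) ∧ LipschitzWith 1 f}
  let r : B → ℕ → ℝ := fun f i => f.1 (TopologicalSpace.denseSeq E i)
  let _ : TopologicalSpace B := TopologicalSpace.induced r inferInstance
  have : SecondCountableTopology B :=
    TopologicalSpace.secondCountableTopology_induced B (ℕ → ℝ) r
  let F : ℕ → B := TopologicalSpace.denseSeq B
  refine ⟨fun n => (F n).1, fun n => (F n).2, fun ρ ρ' _ _ => ?_⟩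
  have hb := bddAbove_blDist ρ ρ'
  have hbF : BddAbove (Set.range fun n => |(∫ x, (F n).1 x ∂ρ) - ∫ x, (F n).1 x ∂ρ'|) :=
    hb.mono (by rintro _ ⟨n, rfl⟩; exact ⟨F n, rfl⟩)
  -- pointwise convergence on a dense sequence, together with the common Lipschitz constant, gives
  -- pointwise convergence everywhere, and then convergence of the integrals
  refine le_antisymm (blDist_le fun f hf1 hfL => ?_) (ciSup_le fun n => le_ciSup hb (F n))
  obtain ⟨u, hu, hlim⟩ := mem_closure_iff_seq_limit.1
    (TopologicalSpace.denseRange_denseSeq B (⟨f, hf1, hfL⟩ : B))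
  have hdense : ∀ i, Tendsto (fun n => (u n).1 (TopologicalSpace.denseSeq E i)) atTop
      (𝓝 (f (TopologicalSpace.denseSeq E i))) := fun i => by
    have hr : Continuous r := continuous_induced_dom
    exact ((continuous_apply i).tendsto _).comp ((hr.tendsto _).comp hlim)
  have hpt : ∀ x, Tendsto (fun n => (u n).1 x) atTop (𝓝 (f x)) := fun x => by
    rw [Metric.tendsto_atTop]
    intro ε hε
    obtain ⟨_, hx, ⟨i, rfl⟩⟩ :=
      Metric.dense_iff.1 (TopologicalSpace.denseRange_denseSeq E) x (ε / 3) (by positivity)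
    obtain ⟨N, hN⟩ := Metric.tendsto_atTop.1 (hdense i) (ε / 3) (by positivity)
    refine ⟨N, fun n hn => ?_⟩
    set y := TopologicalSpace.denseSeq E i
    have h1 := (u n).2.2.dist_le_mul x y
    have h2 := hfL.dist_le_mul y x
    have h3 := hN n hn
    rw [Metric.mem_ball] at hx
    rw [dist_comm y x] at hx
    simp only [NNReal.coe_one, one_mul] at h1 h2
    rw [dist_comm y x] at h2
    calc dist ((u n).1 x) (f x) ≤ dist ((u n).1 x) ((u n).1 y) + dist ((u n).1 y) (f y)
          + dist (f y) (f x) := dist_triangle4 _ _ _ _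
      _ < ε := by linarith
  have hint : ∀ (ρ : Measure E) [IsProbabilityMeasure ρ],
      Tendsto (fun n => ∫ x, (u n).1 x ∂ρ) atTop (𝓝 (∫ x, f x ∂ρ)) := fun ρ _ =>
    tendsto_integral_of_dominated_convergence (fun _ => 1)
      (fun n => (u n).2.2.continuous.measurable.aestronglyMeasurable) (integrable_const _)
      (fun n => Eventually.of_forall (u n).2.1) (Eventually.of_forall hpt)
  refine le_of_tendsto' ((hint ρ).sub (hint ρ')).abs fun n => ?_
  obtain ⟨m, hm⟩ := hu n
  rw [← hm]
  exact le_ciSup hbF m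

theorem measurable_blDist [SecondCountableTopology E] [Nonempty E] {Ω : Type*} [MeasurableSpace Ω]
    (κ κ' : Kernel Ω E) [IsMarkovKernel κ] [IsMarkovKernel κ'] :
    Measurable fun ω => blDist (κ ω) (κ' ω) := by
  obtain ⟨F, hF, hsup⟩ := exists_countable_blDist (E := E)
  simp only [hsup]
  refine Measurable.iSup fun n => ?_
  have hm : ∀ (κ : Kernel Ω E) [IsMarkovKernel κ], Measurable fun ω => ∫ x, F n x ∂(κ ω) :=
    fun κ _ => ((hF n).2.continuous.measurable.stronglyMeasurable.comp_measurable
      measurable_snd |>.integral_kernel_prod_right' (κ := κ)).measurable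
  exact ((hm κ).sub (hm κ')).abs

end BoundedLipschitz

/-! ### One step of the filter and Bayes' formula -/

section FilterStep

set_option linter.unusedSectionVars false

variable {V : Type*} [NormedAddCommGroup V] [InnerProductSpace ℝ V] [FiniteDimensional ℝ V]
  [MeasurableSpace V] [BorelSpace V]
  {E : Type*} [MeasurableSpace E] {Z : Type*} [MeasurableSpace Z]

/-- The law of `((Z, Y), X)`, where `Z` has law `lam`, `X` has conditional law `κ` given `Z`, and
`Y = h X + ξ` with independent noise `ξ`. -/
noncomputable def stepLaw (lam : Measure Z) (κ : Kernel Z E) (h : E → V) (ξ : Measure V) :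
    Measure ((Z × V) × E) :=
  ((lam ⊗ₘ κ).prod ξ).map fun p => ((p.1.1, h p.1.2 + p.2), p.1.2)

/-- The density `∫ q(y - h x) κ(z, dx)` of the conditional law of `Y = h X + ξ` given `Z = z`. -/
noncomputable def obsDensity (κ : Kernel Z E) (h : E → V) (q : V → ℝ) (p : Z × V) : ℝ≥0∞ :=
  ∫⁻ x, ENNReal.ofReal (q (p.2 - h x)) ∂(κ p.1)

variable {lam lam' : Measure Z} [IsProbabilityMeasure lam] [IsProbabilityMeasure lam']
  {κ κ' : Kernel Z E} [IsMarkovKernel κ] [IsMarkovKernel κ'] {h : E → V} {ξ : Measure V}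
  [IsProbabilityMeasure ξ] {q : V → ℝ}

theorem measurable_lintegral_update (hh : Measurable h) (hq : Measurable q)
    (κ : Kernel Z E) [IsMarkovKernel κ]
    {F : (Z × V) × E → ℝ≥0∞} (hF : Measurable F) :
    Measurable fun p : Z × V => ∫⁻ x, F (p, x) * ENNReal.ofReal (q (p.2 - h x)) ∂(κ p.1) :=
  Measurable.lintegral_kernel_prod_right' (κ := κ.comap Prod.fst measurable_fst)
    (f := fun s : (Z × V) × E => F s * ENNReal.ofReal (q (s.1.2 - h s.2))) (by fun_prop)

theorem measurable_obsDensity (hh : Measurable h) (hq : Measurable q)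
    (κ : Kernel Z E) [IsMarkovKernel κ] :
    Measurable (obsDensity κ h q) := by
  have := measurable_lintegral_update hh hq κ (F := fun _ => 1) measurable_const
  simp only [one_mul] at this
  exact this

theorem lintegral_stepLaw (hh : Measurable h) (hq : Measurable q)
    (hξ : ξ = volume.withDensity fun y => ENNReal.ofReal (q y)) {F : (Z × V) × E → ℝ≥0∞}
    (hF : Measurable F) :
    ∫⁻ s, F s ∂(stepLaw lam κ h ξ) =
      ∫⁻ p, ∫⁻ x, F (p, x) * ENNReal.ofReal (q (p.2 - h x)) ∂(κ p.1) ∂(lam.prod volume) := by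
  rw [stepLaw, lintegral_map hF (by fun_prop), lintegral_prod _ (by fun_prop),
    Measure.lintegral_compProd
      (f := fun p : Z × E => ∫⁻ w, F ((p.1, h p.2 + w), p.2) ∂ξ)
      (Measurable.lintegral_prod_right' (f := fun s : (Z × E) × V =>
        F ((s.1.1, h s.1.2 + s.2), s.1.2)) (by fun_prop)),
    lintegral_prod _ (measurable_lintegral_update hh hq κ hF).aemeasurable]
  refine lintegral_congr fun z => ?_
  dsimp only
  rw [lintegral_lintegral_swap (f := fun y x => F ((z, y), x) * ENNReal.ofReal (q (y - h x)))
    (by fun_prop)]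
  refine lintegral_congr fun x => ?_
  rw [hξ, lintegral_withDensity_eq_lintegral_mul _ (by fun_prop) (by fun_prop),
    ← lintegral_add_left_eq_self (fun y => F ((z, y), x) * ENNReal.ofReal (q (y - h x))) (h x)]
  simp [mul_comm]

/-- `obsDensity` is the conditional density of `Y` given `Z`. -/
theorem stepLaw_fst_eq_withDensity (hh : Measurable h) (hq : Measurable q)
    (hξ : ξ = volume.withDensity fun y => ENNReal.ofReal (q y)) :
    (stepLaw lam κ h ξ).fst = (lam.prod volume).withDensity (obsDensity κ h q) := by
  ext s hs
  rw [withDensity_apply _ hs, Measure.fst_apply hs, ← lintegral_indicator_one (measurable_fst hs),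
    lintegral_stepLaw hh hq hξ (measurable_one.indicator (measurable_fst hs)),
    ← lintegral_indicator hs]
  refine lintegral_congr fun p => ?_
  by_cases hp : p ∈ s
  · simp [hp, obsDensity]
  · simp [hp]

theorem isProbabilityMeasure_stepLaw (hh : Measurable h) :
    IsProbabilityMeasure (stepLaw lam κ h ξ) :=
  Measure.isProbabilityMeasure_map (by fun_prop)

theorem obsDensity_ae_lt_top (hh : Measurable h) (hq : Measurable q)
    (hξ : ξ = volume.withDensity fun y => ENNReal.ofReal (q y)) :
    ∀ᵐ p ∂(lam.prod volume), obsDensity κ h q p < ∞ := by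
  refine ae_lt_top (measurable_obsDensity hh hq κ) ?_
  rw [← setLIntegral_univ, ← withDensity_apply _ MeasurableSet.univ,
    ← stepLaw_fst_eq_withDensity (lam := lam) (κ := κ) hh hq hξ]
  have := isProbabilityMeasure_stepLaw (lam := lam) (κ := κ) (ξ := ξ) hh
  exact measure_ne_top _ _

/-- Bayes' formula for the conditional law `π` of `X` given `(Z, Y)`. -/
theorem bayes_lintegral (hh : Measurable h) (hq : Measurable q)
    (hξ : ξ = volume.withDensity fun y => ENNReal.ofReal (q y)) {π : Kernel (Z × V) E}
    [IsMarkovKernel π] (hπ : (stepLaw lam κ h ξ).fst ⊗ₘ π = stepLaw lam κ h ξ)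
    {f : E → ℝ≥0∞} (hf : Measurable f) :
    ∀ᵐ p ∂(lam.prod volume), obsDensity κ h q p * ∫⁻ x, f x ∂(π p) =
      ∫⁻ x, f x * ENNReal.ofReal (q (p.2 - h x)) ∂(κ p.1) := by
  have hpm := measurable_obsDensity hh hq κ
  refine ae_eq_of_forall_setLIntegral_eq_of_sigmaFinite
    (hpm.mul (Measurable.lintegral_kernel hf))
    (measurable_lintegral_update hh hq κ (F := fun s => f s.2) (by fun_prop)) fun s hs _ => ?_
  have hm : Measurable fun t : (Z × V) × E => s.indicator (1 : Z × V → ℝ≥0∞) t.1 * f t.2 :=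
    ((measurable_one.indicator hs).comp measurable_fst).mul (hf.comp measurable_snd)
  have := isProbabilityMeasure_stepLaw (lam := lam) (κ := κ) (ξ := ξ) hh
  have h1 : ∫⁻ t, s.indicator 1 t.1 * f t.2 ∂(stepLaw lam κ h ξ) =
      ∫⁻ p in s, ∫⁻ x, f x * ENNReal.ofReal (q (p.2 - h x)) ∂(κ p.1) ∂(lam.prod volume) := by
    rw [lintegral_stepLaw hh hq hξ hm,
      ← lintegral_indicator hs]
    refine lintegral_congr fun p => ?_
    by_cases hp : p ∈ s <;> simp [hp]
  have h2 : ∫⁻ t, s.indicator 1 t.1 * f t.2 ∂(stepLaw lam κ h ξ) =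
      ∫⁻ p in s, obsDensity κ h q p * ∫⁻ x, f x ∂(π p) ∂(lam.prod volume) := by
    rw [← hπ, Measure.lintegral_compProd hm,
      stepLaw_fst_eq_withDensity hh hq hξ,
      lintegral_withDensity_eq_lintegral_mul _ hpm
        (Measurable.lintegral_kernel_prod_right' (κ := π) hm),
      ← lintegral_indicator hs]
    refine lintegral_congr fun p => ?_
    by_cases hp : p ∈ s <;> simp [hp]
  exact h2.symm.trans h1

theorem bayes_integral (hh : Measurable h) (hq : Measurable q) (hq0 : ∀ y, 0 ≤ q y)
    (hξ : ξ = volume.withDensity fun y => ENNReal.ofReal (q y)) {π : Kernel (Z × V) E}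
    [IsMarkovKernel π] (hπ : (stepLaw lam κ h ξ).fst ⊗ₘ π = stepLaw lam κ h ξ)
    {f : E → ℝ} (hf : Measurable f) (hf1 : ∀ x, |f x| ≤ 1) :
    ∀ᵐ p ∂(lam.prod volume), (obsDensity κ h q p).toReal * ∫ x, f x ∂(π p) =
      ∫ x, f x * q (p.2 - h x) ∂(κ p.1) := by
  filter_upwards [bayes_lintegral hh hq hξ hπ (f := fun x => ENNReal.ofReal (f x + 1))
    (by fun_prop), obsDensity_ae_lt_top (lam := lam) (κ := κ) hh hq hξ] with p hp hfin
  have hf0 : ∀ x, 0 ≤ f x + 1 := fun x => by linarith [(abs_le.1 (hf1 x)).1]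
  have hfi : Integrable f (π p) :=
    Integrable.of_bound hf.aestronglyMeasurable 1 (Eventually.of_forall hf1)
  have hqi : Integrable (fun x => q (p.2 - h x)) (κ p.1) := by
    refine ⟨Measurable.aestronglyMeasurable (by fun_prop), ?_⟩
    simp only [HasFiniteIntegral, Real.enorm_of_nonneg (hq0 _)]
    exact hfin
  have hfqi : Integrable (fun x => f x * q (p.2 - h x)) (κ p.1) :=
    hqi.bdd_mul (c := 1) hf.aestronglyMeasurable (Eventually.of_forall hf1)
  have h1 : (∫⁻ x, ENNReal.ofReal (f x + 1) ∂(π p)).toReal = (∫ x, f x ∂(π p)) + 1 := by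
    rw [← integral_eq_lintegral_of_nonneg_ae (Eventually.of_forall hf0)
      (Measurable.aestronglyMeasurable (by fun_prop)), integral_add hfi (integrable_const _)]
    simp
  have h2 : (∫⁻ x, ENNReal.ofReal (f x + 1) * ENNReal.ofReal (q (p.2 - h x)) ∂(κ p.1)).toReal =
      (∫ x, f x * q (p.2 - h x) ∂(κ p.1)) + (obsDensity κ h q p).toReal := by
    simp only [← ENNReal.ofReal_mul (hf0 _)]
    rw [← integral_eq_lintegral_of_nonneg_ae
      (Eventually.of_forall fun x => mul_nonneg (hf0 x) (hq0 _))
      (Measurable.aestronglyMeasurable (by fun_prop)), obsDensity,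
      ← integral_eq_lintegral_of_nonneg_ae (Eventually.of_forall fun x => hq0 _)
      (Measurable.aestronglyMeasurable (by fun_prop)), ← integral_add hfqi hqi]
    simp only [add_mul, one_mul]
  have h3 := congrArg ENNReal.toReal hp
  rw [ENNReal.toReal_mul, h1, h2] at h3
  linarith

end FilterStep

/-! ### Comparison of two filters over one step -/

section FilterComparison

set_option linter.unusedSectionVars false

variable {V : Type*} [NormedAddCommGroup V] [InnerProductSpace ℝ V] [FiniteDimensional ℝ V]
  [MeasurableSpace V] [BorelSpace V]
  {E : Type*} [MetricSpace E] [MeasurableSpace E] [BorelSpace E] {Z : Type*} [MeasurableSpace Z]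
  {lam lam' : Measure Z} [IsProbabilityMeasure lam] [IsProbabilityMeasure lam']
  {κ κ' : Kernel Z E} [IsMarkovKernel κ] [IsMarkovKernel κ'] {h : E → V} {ξ : Measure V}
  [IsProbabilityMeasure ξ] {q : V → ℝ}

theorem convDiffNorm_map_eq (hh : Measurable h) (hq : Measurable q) (hq0 : ∀ y, 0 ≤ q y) (z : Z) :
    convDiffNorm ((κ z).map h) ((κ' z).map h) (fun y => (q y : ℂ)) =
      ∫⁻ y, ‖(obsDensity κ h q (z, y)).toReal - (obsDensity κ' h q (z, y)).toReal‖ₑ := by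
  refine lintegral_congr fun y => ?_
  rw [convDiff_map_ofReal (κ z) (κ' z) hh hq, ← ofReal_norm, ← ofReal_norm, Complex.norm_real]
  have : ∀ κ : Kernel Z E, ∫ x, q (y - h x) ∂(κ z) = (obsDensity κ h q (z, y)).toReal := fun κ =>
    integral_eq_lintegral_of_nonneg_ae (Eventually.of_forall fun x => hq0 _)
      (Measurable.aestronglyMeasurable (by fun_prop))
  rw [this, this]

/-- The two filters are compared through `p |A/p - A'/p'| ≤ |A - A'| + |p - p'|`, where `A` and `p`
are the numerator and the denominator in Bayes' formula. -/
theorem ofReal_blDist_mul_le {a a' : ℝ} {ρ ρ' κ κ' : Measure E} [IsProbabilityMeasure ρ']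
    (ha : 0 ≤ a) {w : E → ℝ} {G : ℝ≥0∞} {F : ℕ → E → ℝ} (hF1 : ∀ n x, |F n x| ≤ 1)
    (hsup : blDist ρ ρ' = ⨆ n, |(∫ x, F n x ∂ρ) - ∫ x, F n x ∂ρ'|)
    (h1 : ∀ n, a * ∫ x, F n x ∂ρ = ∫ x, F n x * w x ∂κ)
    (h2 : ∀ n, a' * ∫ x, F n x ∂ρ' = ∫ x, F n x * w x ∂κ')
    (hG : ∀ n, ‖(∫ x, F n x * w x ∂κ) - ∫ x, F n x * w x ∂κ'‖ₑ ≤ G) :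
    ENNReal.ofReal a * ENNReal.ofReal (blDist ρ ρ') ≤ G + ‖a - a'‖ₑ := by
  rcases eq_or_ne G ∞ with rfl | hGtop
  · simp
  rw [← ENNReal.ofReal_mul ha, ← ENNReal.ofReal_toReal hGtop, Real.enorm_eq_ofReal_abs,
    ← ENNReal.ofReal_add ENNReal.toReal_nonneg (abs_nonneg _), hsup, Real.mul_iSup_of_nonneg ha]
  refine ENNReal.ofReal_le_ofReal (ciSup_le fun n => ?_)
  have hGn : |(∫ x, F n x * w x ∂κ) - ∫ x, F n x * w x ∂κ'| ≤ G.toReal := by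
    have := hG n
    rw [Real.enorm_eq_ofReal_abs] at this
    exact (ENNReal.ofReal_le_iff_le_toReal hGtop).1 this
  rw [← h1, ← h2] at hGn
  have hb : |∫ x, F n x ∂ρ'| ≤ 1 := abs_integral_le_one (hF1 n)
  calc a * |(∫ x, F n x ∂ρ) - ∫ x, F n x ∂ρ'|
      = |(a * (∫ x, F n x ∂ρ) - a' * ∫ x, F n x ∂ρ') - (a - a') * ∫ x, F n x ∂ρ'| := by
        rw [← abs_of_nonneg ha, ← abs_mul, abs_of_nonneg ha]
        congr 1
        ring
    _ ≤ |a * (∫ x, F n x ∂ρ) - a' * ∫ x, F n x ∂ρ'| + |(a - a') * ∫ x, F n x ∂ρ'| := abs_sub _ _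
    _ ≤ G.toReal + |a - a'| := by
        rw [abs_mul (a - a')]
        exact add_le_add hGn (mul_le_of_le_one_right (abs_nonneg _) hb)

/-- The mean distance of the filters `π`, `π'` after one observation is controlled by the mean total
variation distance of the conditional laws of that observation. The bound on unnormalized updates is
applied for each `z` separately, with the same constants `ε` and `C`. -/
theorem lintegral_blDist_le [SecondCountableTopology E] [Nonempty E]
    (hh : Measurable h) (hq : Measurable q) (hq0 : ∀ y, 0 ≤ q y)
    (hξ : ξ = volume.withDensity fun y => ENNReal.ofReal (q y)) (hac : lam ≪ lam')
    {π π' : Kernel (Z × V) E} [IsMarkovKernel π] [IsMarkovKernel π']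
    (hπ : (stepLaw lam κ h ξ).fst ⊗ₘ π = stepLaw lam κ h ξ)
    (hπ' : (stepLaw lam' κ' h ξ).fst ⊗ₘ π' = stepLaw lam' κ' h ξ) {ε C : ℝ≥0∞} (hC : C ≠ ∞)
    (hG : ∀ (κ κ' : Measure E) [IsProbabilityMeasure κ] [IsProbabilityMeasure κ'],
      ∃ G : V → ℝ≥0∞,
        ∫⁻ y, G y ≤ ε + C * convDiffNorm (κ.map h) (κ'.map h) (fun y => (q y : ℂ)) ∧
        ∀ᵐ y, ∀ f : E → ℝ, (∀ x, |f x| ≤ 1) → LipschitzWith 1 f →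
          ‖(∫ x, f x * q (y - h x) ∂κ) - ∫ x, f x * q (y - h x) ∂κ'‖ₑ ≤ G y) :
    ∫⁻ p, ENNReal.ofReal (blDist (π p) (π' p)) ∂(stepLaw lam κ h ξ).fst ≤
      ε + (C + 1) * ∫⁻ z, (∫⁻ y, ‖(obsDensity κ h q (z, y)).toReal -
        (obsDensity κ' h q (z, y)).toReal‖ₑ) ∂lam := by
  obtain ⟨F, hF, hsup⟩ := exists_countable_blDist (E := E)
  have hFm : ∀ n, Measurable (F n) := fun n => (hF n).2.continuous.measurable
  have hpm := measurable_obsDensity hh hq κ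
  have hpm' := measurable_obsDensity hh hq κ'
  have hbl : Measurable fun p => ENNReal.ofReal (blDist (π p) (π' p)) :=
    (measurable_blDist π π').ennreal_ofReal
  have hB := ae_all_iff.2 fun n => bayes_integral hh hq hq0 hξ hπ (hFm n) (hF n).1
  -- Bayes' formula for `π'` holds almost everywhere for `lam'`, hence for `lam`
  have hB' := (hac.prod (.refl (volume : Measure V))).ae_le
    (ae_all_iff.2 fun n => bayes_integral hh hq hq0 hξ hπ' (hFm n) (hF n).1)
  have hfin := obsDensity_ae_lt_top (lam := lam) (κ := κ) hh hq hξ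
  rw [stepLaw_fst_eq_withDensity hh hq hξ, lintegral_withDensity_eq_lintegral_mul _ hpm hbl,
    lintegral_prod _ (hpm.mul hbl).aemeasurable]
  have hz : ∀ᵐ z ∂lam, ∫⁻ y, (obsDensity κ h q * fun p => ENNReal.ofReal (blDist (π p) (π' p)))
      (z, y) ≤ ε + (C + 1) * ∫⁻ y, ‖(obsDensity κ h q (z, y)).toReal -
        (obsDensity κ' h q (z, y)).toReal‖ₑ := by
    filter_upwards [Measure.ae_ae_of_ae_prod hB, Measure.ae_ae_of_ae_prod hB',
      Measure.ae_ae_of_ae_prod hfin] with z h1 h2 h3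
    obtain ⟨G, hGint, hGle⟩ := hG (κ z) (κ' z)
    rw [convDiffNorm_map_eq hh hq hq0] at hGint
    calc ∫⁻ y, (obsDensity κ h q * fun p => ENNReal.ofReal (blDist (π p) (π' p))) (z, y)
        ≤ ∫⁻ y, (G y + ‖(obsDensity κ h q (z, y)).toReal -
            (obsDensity κ' h q (z, y)).toReal‖ₑ) := by
          refine lintegral_mono_ae ?_
          filter_upwards [h1, h2, h3, hGle] with y h1y h2y h3y hGy
          have := ofReal_blDist_mul_le (w := fun x => q (y - h x)) ENNReal.toReal_nonneg
            (fun n => (hF n).1) (hsup (π (z, y)) (π' (z, y))) h1y h2y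
            fun n => hGy (F n) (hF n).1 (hF n).2
          rwa [ENNReal.ofReal_toReal h3y.ne] at this
      _ = (∫⁻ y, G y) + ∫⁻ y, ‖(obsDensity κ h q (z, y)).toReal -
            (obsDensity κ' h q (z, y)).toReal‖ₑ := by
          refine lintegral_add_right _ ?_
          exact ((hpm.comp measurable_prodMk_left).ennreal_toReal.sub
            (hpm'.comp measurable_prodMk_left).ennreal_toReal).enorm
      _ ≤ _ := by
          refine (add_le_add_left hGint _).trans (le_of_eq ?_)
          ring
  refine (lintegral_mono_ae hz).trans (le_of_eq ?_)
  rw [lintegral_add_left measurable_const, lintegral_const_mul' _ _ (by simp [hC])]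
  simp

/-- The mean total variation distance of the two one-step predictive laws of `Y` given `Z` is at most
the `L¹` distance of the likelihood ratio of `Z` and that of `(Z, Y)`. -/
theorem lintegral_obsDensity_sub_le (hh : Measurable h) (hq : Measurable q)
    (hξ : ξ = volume.withDensity fun y => ENNReal.ofReal (q y)) {L : Z → ℝ≥0} (hL : Measurable L)
    {L' : Z × V → ℝ≥0} (hL' : Measurable L') (hlam : lam = lam'.withDensity fun z => L z)
    (hstep : (stepLaw lam κ h ξ).fst = (stepLaw lam' κ' h ξ).fst.withDensity fun p => L' p) :
    ∫⁻ z, (∫⁻ y, ‖(obsDensity κ h q (z, y)).toReal -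
        (obsDensity κ' h q (z, y)).toReal‖ₑ) ∂lam ≤
      ∫⁻ p, ‖(L' p : ℝ) - L p.1‖ₑ ∂(stepLaw lam' κ' h ξ).fst := by
  have hpm := measurable_obsDensity hh hq κ
  have hpm' := measurable_obsDensity hh hq κ'
  have hm : Measurable fun p => ‖(obsDensity κ h q p).toReal - (obsDensity κ' h q p).toReal‖ₑ :=
    (hpm.ennreal_toReal.sub hpm'.ennreal_toReal).enorm
  have hL1 : Measurable fun z : Z => (L z : ℝ≥0∞) := hL.coe_nnreal_ennreal
  have hL1' : Measurable fun z => (L' z : ℝ≥0∞) := hL'.coe_nnreal_ennreal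
  have hdens : (fun p : Z × V => (L p.1 : ℝ≥0∞) * obsDensity κ h q p)
      =ᵐ[lam'.prod volume] fun p => obsDensity κ' h q p * L' p := by
    have h1 : (stepLaw lam κ h ξ).fst = (lam'.prod volume).withDensity
        fun p : Z × V => (L p.1 : ℝ≥0∞) * obsDensity κ h q p := by
      rw [stepLaw_fst_eq_withDensity hh hq hξ]
      have : lam.prod (volume : Measure V) =
          (lam'.prod volume).withDensity fun p => (L p.1 : ℝ≥0∞) := by
        conv_lhs => rw [hlam]
        exact prod_withDensity_left hL1
      rw [this, ← withDensity_mul _ (by fun_prop) hpm]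
      rfl
    have h2 : (stepLaw lam κ h ξ).fst = (lam'.prod volume).withDensity
        fun p => obsDensity κ' h q p * L' p := by
      rw [hstep, stepLaw_fst_eq_withDensity hh hq hξ, ← withDensity_mul _ hpm' hL1']
      rfl
    have hprob := isProbabilityMeasure_stepLaw (lam := lam) (κ := κ) (ξ := ξ) hh
    refine (withDensity_eq_iff (by fun_prop) (by fun_prop) ?_).1 (h1.symm.trans h2)
    rw [← setLIntegral_univ, ← withDensity_apply _ MeasurableSet.univ, ← h1]
    exact measure_ne_top _ _
  have hfin' := obsDensity_ae_lt_top (lam := lam') (κ := κ') hh hq hξ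
  rw [hlam, lintegral_withDensity_eq_lintegral_mul _ hL1 hm.lintegral_prod_right',
    stepLaw_fst_eq_withDensity hh hq hξ,
    lintegral_withDensity_eq_lintegral_mul _ hpm' (by fun_prop)]
  have : ∀ z, ((fun z => (L z : ℝ≥0∞)) * fun z => ∫⁻ y, ‖(obsDensity κ h q (z, y)).toReal -
      (obsDensity κ' h q (z, y)).toReal‖ₑ) z = ∫⁻ y, L z * ‖(obsDensity κ h q (z, y)).toReal -
      (obsDensity κ' h q (z, y)).toReal‖ₑ := fun z => by
    rw [lintegral_const_mul' _ _ (by simp)]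
    rfl
  simp only [this]
  rw [← lintegral_prod (fun p : Z × V => (L p.1 : ℝ≥0∞) * ‖(obsDensity κ h q p).toReal -
      (obsDensity κ' h q p).toReal‖ₑ) (by fun_prop)]
  refine lintegral_mono_ae ?_
  filter_upwards [hdens, hfin'] with p hp hp'
  have hreal := congrArg ENNReal.toReal hp
  simp only [ENNReal.toReal_mul, ENNReal.coe_toReal] at hreal
  simp only [Pi.mul_apply]
  set b := (obsDensity κ' h q p).toReal
  have hb : obsDensity κ' h q p = ENNReal.ofReal b := (ENNReal.ofReal_toReal hp'.ne).symm
  have hLe : (L p.1 : ℝ≥0∞) = ENNReal.ofReal (L p.1 : ℝ) := by simp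
  rw [hb, hLe, Real.enorm_eq_ofReal_abs, Real.enorm_eq_ofReal_abs,
    ← ENNReal.ofReal_mul (by positivity), ← ENNReal.ofReal_mul ENNReal.toReal_nonneg]
  apply ENNReal.ofReal_le_ofReal
  rw [← abs_of_nonneg (show (0 : ℝ) ≤ L p.1 by positivity), ← abs_mul, NNReal.abs_eq,
    mul_sub, hreal, ← mul_comm b (L p.1 : ℝ), ← mul_sub, abs_mul,
    abs_of_nonneg (show 0 ≤ b from ENNReal.toReal_nonneg)]

end FilterComparison

/-! ### Merging of likelihood ratios -/

section Merging

variable {V : Type*} [MeasurableSpace V]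

/-- The likelihood ratio `dP/dQ` of the first `k + 1` coordinates, with values in `ℝ≥0`: the
Radon–Nikodym derivative is finite almost everywhere, and its infinite values are replaced by `0`. -/
noncomputable def likelihood (P Q : Measure (ℕ → V)) (k : ℕ) (y : Finset.Iic k → V) : ℝ≥0 :=
  ((P.map (Preorder.frestrictLe k)).rnDeriv (Q.map (Preorder.frestrictLe k)) y).toNNReal

theorem measurable_likelihood (P Q : Measure (ℕ → V)) (k : ℕ) : Measurable (likelihood P Q k) :=
  (Measure.measurable_rnDeriv _ _).ennreal_toNNReal

theorem iSup_piLE : ⨆ k, Filtration.piLE (X := fun _ : ℕ => V) k = MeasurableSpace.pi := by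
  refine le_antisymm (iSup_le fun k => Filtration.piLE.le k) (iSup_le fun k => ?_)
  refine le_trans ?_ (le_iSup _ k)
  rw [Filtration.piLE_eq_comap_frestrictLe]
  have : (fun y : ℕ → V => y k) =
      (fun z : Finset.Iic k → V => z ⟨k, by simp⟩) ∘ Preorder.frestrictLe (π := fun _ => V) k := rfl
  rw [this, ← MeasurableSpace.comap_comp]
  exact MeasurableSpace.comap_mono (measurable_pi_apply _).comap_le

variable {P Q : Measure (ℕ → V)} [IsProbabilityMeasure P] [IsProbabilityMeasure Q]

theorem withDensity_likelihood (hPQ : P ≪ Q) (k : ℕ) :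
    P.map (Preorder.frestrictLe k) =
      (Q.map (Preorder.frestrictLe k)).withDensity fun y => likelihood P Q k y := by
  have hm : Measurable (Preorder.frestrictLe (π := fun _ => V) k) := by fun_prop
  have := Measure.isProbabilityMeasure_map (μ := P) hm.aemeasurable
  have := Measure.isProbabilityMeasure_map (μ := Q) hm.aemeasurable
  conv_lhs => rw [← Measure.withDensity_rnDeriv_eq _ _ (hPQ.map hm)]
  refine withDensity_congr_ae ?_
  filter_upwards [Measure.rnDeriv_ne_top (P.map (Preorder.frestrictLe k))
    (Q.map (Preorder.frestrictLe k))] with y hy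
  exact (ENNReal.coe_toNNReal hy).symm

/-- Successive likelihood ratios merge in `L¹(Q)`: they form a martingale closed by `dP/dQ`, so this
is Lévy's upward theorem. -/
theorem tendsto_lintegral_likelihood_sub (hPQ : P ≪ Q) :
    Tendsto (fun k => ∫⁻ y, ‖(likelihood P Q (k + 1) (Preorder.frestrictLe (k + 1) y) : ℝ) -
      likelihood P Q k (Preorder.frestrictLe k y)‖ₑ ∂Q) atTop (𝓝 0) := by
  let Λ : (ℕ → V) → ℝ := fun y => (P.rnDeriv Q y).toReal
  have hΛ : Integrable Λ Q := Measure.integrable_toReal_rnDeriv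
  have hM : ∀ k, (fun y => (likelihood P Q k (Preorder.frestrictLe k y) : ℝ)) =ᵐ[Q]
      Q[Λ | Filtration.piLE (X := fun _ : ℕ => V) k] := fun k => by
    have hm : Measurable (Preorder.frestrictLe (π := fun _ => V) k) := by fun_prop
    rw [Filtration.piLE_eq_comap_frestrictLe]
    exact toReal_rnDeriv_map hPQ hm
  have hlim : Tendsto (fun k => eLpNorm (Q[Λ | Filtration.piLE (X := fun _ : ℕ => V) k] - Λ) 1 Q)
      atTop (𝓝 0) := by
    refine hΛ.tendsto_eLpNorm_condExp ?_
    rw [iSup_piLE]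
    exact (Measure.measurable_rnDeriv P Q).ennreal_toReal.stronglyMeasurable
  have hsum := ((tendsto_add_atTop_iff_nat 1).2 hlim).add hlim
  rw [add_zero] at hsum
  refine tendsto_of_tendsto_of_tendsto_of_le_of_le tendsto_const_nhds hsum
    (fun _ => zero_le) fun k => ?_
  have hint : ∀ k, AEStronglyMeasurable (Q[Λ | Filtration.piLE (X := fun _ : ℕ => V) k] - Λ) Q :=
    fun k => (integrable_condExp.sub hΛ).1
  calc ∫⁻ y, ‖(likelihood P Q (k + 1) (Preorder.frestrictLe (k + 1) y) : ℝ) -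
        likelihood P Q k (Preorder.frestrictLe k y)‖ₑ ∂Q
      = eLpNorm ((Q[Λ | Filtration.piLE (X := fun _ : ℕ => V) (k + 1)] - Λ) -
          (Q[Λ | Filtration.piLE (X := fun _ : ℕ => V) k] - Λ)) 1 Q := by
        rw [eLpNorm_one_eq_lintegral_enorm]
        refine lintegral_congr_ae ?_
        filter_upwards [hM k, hM (k + 1)] with y h1 h2
        rw [h1, h2]
        simp
    _ ≤ _ := eLpNorm_sub_le (hint _) (hint _) le_rfl

end Merging

/-! ### Regular conditional laws under a change of conditioning variable -/

section CondDistrib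

variable {Ω A B E : Type*} [MeasurableSpace Ω] [MeasurableSpace A] [MeasurableSpace B]
  [MeasurableSpace E] [StandardBorelSpace E] [Nonempty E]

/-- A regular conditional law given `W` is one given any `U` that carries the same information. -/
theorem map_compProd_comap_condDistrib (P : Measure Ω) [IsFiniteMeasure P] {X : Ω → E}
    (hX : Measurable X) {W : Ω → A} (hW : Measurable W) {U : Ω → B} (hU : Measurable U)
    {m : B → A} (hm : Measurable m) (hmU : ∀ ω, m (U ω) = W ω)
    {r : A → B} (hr : Measurable r) (hrW : ∀ ω, r (W ω) = U ω) :
    (P.map U) ⊗ₘ (condDistrib X W P).comap m hm = P.map fun ω => (U ω, X ω) := by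
  refine Measure.ext_of_lintegral _ fun F hF => ?_
  have h1 := congrArg (fun ρ : Measure (A × E) => ∫⁻ s, F (r s.1, s.2) ∂ρ)
    (compProd_map_condDistrib (X := W) (μ := P) hX.aemeasurable)
  have hm1 : Measurable fun a => ∫⁻ x, F (r a, x) ∂(condDistrib X W P a) :=
    Measurable.lintegral_kernel_prod_right' (κ := condDistrib X W P)
      (f := fun s : A × E => F (r s.1, s.2)) (by fun_prop)
  have hm2 : Measurable fun b => ∫⁻ x, F (b, x) ∂((condDistrib X W P).comap m hm b) :=
    Measurable.lintegral_kernel_prod_right' (κ := (condDistrib X W P).comap m hm) hF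
  rw [Measure.lintegral_compProd (f := fun s : A × E => F (r s.1, s.2)) (by fun_prop),
    lintegral_map hm1 hW,
    lintegral_map (f := fun s : A × E => F (r s.1, s.2)) (by fun_prop) (by fun_prop)] at h1
  rw [Measure.lintegral_compProd hF, lintegral_map hm2 hU, lintegral_map hF (by fun_prop)]
  simpa only [Kernel.comap_apply, hmU, hrW] using h1

end CondDistrib

/-! ### The noise of the hidden Markov model is fresh at each time -/

section HiddenMarkov

variable {E : Type*} [MeasurableSpace E] {n : ℕ} (P : Kernel E E) [IsMarkovKernel P]
  {h : E → EuclideanSpace ℝ (Fin n)} (ξ : Measure (EuclideanSpace ℝ (Fin n)))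
  [IsProbabilityMeasure ξ] (μ : Measure E) [IsProbabilityMeasure μ]

instance : IsProbabilityMeasure (signalLaw P μ) := by
  unfold signalLaw
  infer_instance

theorem measurable_obsUpTo (k : ℕ) : Measurable (obsUpTo (E := E) (n := n) k) := by
  unfold obsUpTo
  fun_prop

theorem measurable_signal_add_noise (hh : Measurable h) :
    Measurable fun p : (ℕ → E) × (ℕ → EuclideanSpace ℝ (Fin n)) =>
      (p.1, fun k => h (p.1 k) + p.2 k) := by
  fun_prop

theorem isProbabilityMeasure_hmmLaw (hh : Measurable h) : IsProbabilityMeasure (hmmLaw P h ξ μ) :=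
  Measure.isProbabilityMeasure_map (measurable_signal_add_noise hh).aemeasurable

theorem map_noise_frestrictLe_succ (k : ℕ) :
    (Measure.infinitePi fun _ : ℕ => ξ).map (fun w => (Preorder.frestrictLe k w, w (k + 1))) =
      ((Measure.infinitePi fun _ : ℕ => ξ).map (Preorder.frestrictLe k)).prod ξ := by
  have hind : iIndepFun (fun (i : ℕ) (w : ℕ → EuclideanSpace ℝ (Fin n)) => w i)
      (Measure.infinitePi fun _ : ℕ => ξ) :=
    iIndepFun_infinitePi (X := fun _ w => w) fun _ => measurable_id
  have hr : Measurable (Preorder.frestrictLe (π := fun _ => EuclideanSpace ℝ (Fin n)) k) := by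
    fun_prop
  have hdisj : Disjoint (Finset.Iic k) {k + 1} := by simp
  have h1 := hind.indepFun_finset (Finset.Iic k) {k + 1} hdisj fun i => measurable_pi_apply i
  have h2 : IndepFun (Preorder.frestrictLe (π := fun _ => EuclideanSpace ℝ (Fin n)) k)
      (fun w => w (k + 1)) (Measure.infinitePi fun _ : ℕ => ξ) :=
    h1.comp (φ := id) (ψ := fun z : ({k + 1} : Finset ℕ) → EuclideanSpace ℝ (Fin n) =>
      z ⟨k + 1, by simp⟩) measurable_id (measurable_pi_apply _)
  rw [(indepFun_iff_map_prod_eq_prod_map_map hr.aemeasurable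
    (measurable_pi_apply (k + 1)).aemeasurable).1 h2]
  congr 1
  exact Measure.infinitePi_map_eval (fun _ : ℕ => ξ) (k + 1)

/-- Given the first `k + 1` observations and the signal at time `k + 1`, the noise at time `k + 1`
is fresh. -/
theorem map_hmmLaw_eq_stepLaw [StandardBorelSpace E] [Nonempty E] (hh : Measurable h) (k : ℕ) :
    (hmmLaw P h ξ μ).map (fun ω => ((obsUpTo k ω, ω.2 (k + 1)), ω.1 (k + 1))) =
      stepLaw ((hmmLaw P h ξ μ).map (obsUpTo k))
        (condDistrib (fun ω => ω.1 (k + 1)) (obsUpTo k) (hmmLaw P h ξ μ)) h ξ := by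
  have hobs := measurable_obsUpTo (E := E) (n := n) k
  have hT := measurable_signal_add_noise hh (n := n)
  set N := Measure.infinitePi fun _ : ℕ => ξ with hN
  have hr : Measurable (Preorder.frestrictLe (π := fun _ => EuclideanSpace ℝ (Fin n)) k) := by
    fun_prop
  have : IsProbabilityMeasure (N.map (Preorder.frestrictLe k)) :=
    Measure.isProbabilityMeasure_map hr.aemeasurable
  let A : (ℕ → E) × (Finset.Iic k → EuclideanSpace ℝ (Fin n)) →
      (Finset.Iic k → EuclideanSpace ℝ (Fin n)) × E :=
    fun p => (fun i => h (p.1 i) + p.2 i, p.1 (k + 1))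
  have hA : Measurable A := by fun_prop
  let φ : ((Finset.Iic k → EuclideanSpace ℝ (Fin n)) × E) × EuclideanSpace ℝ (Fin n) →
      ((Finset.Iic k → EuclideanSpace ℝ (Fin n)) × EuclideanSpace ℝ (Fin n)) × E :=
    fun p => ((p.1.1, h p.1.2 + p.2), p.1.2)
  have hφ : Measurable φ := by fun_prop
  have hsplit : ((signalLaw P μ).prod N).map
      (fun p => ((p.1, Preorder.frestrictLe k p.2), p.2 (k + 1))) =
      ((signalLaw P μ).prod (N.map (Preorder.frestrictLe k))).prod ξ := by
    have h1 : MeasurePreserving (fun w : ℕ → EuclideanSpace ℝ (Fin n) =>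
        (Preorder.frestrictLe k w, w (k + 1))) N ((N.map (Preorder.frestrictLe k)).prod ξ) :=
      ⟨by fun_prop, map_noise_frestrictLe_succ ξ k⟩
    have h2 := (MeasurePreserving.id (signalLaw P μ)).prod h1
    have h3 := (measurePreserving_prodAssoc (signalLaw P μ) (N.map (Preorder.frestrictLe k)) ξ).symm
    exact (h3.comp h2).map_eq
  have hfst : (hmmLaw P h ξ μ).map (fun ω => (obsUpTo k ω, ω.1 (k + 1))) =
      ((signalLaw P μ).prod (N.map (Preorder.frestrictLe k))).map A := by
    have h1 := congrArg (Measure.map Prod.fst) hsplit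
    rw [Measure.map_map measurable_fst (by fun_prop), Measure.map_fst_prod, measure_univ,
      one_smul] at h1
    rw [← h1, Measure.map_map hA (by fun_prop), hmmLaw, Measure.map_map (by fun_prop) hT]
    rfl
  rw [stepLaw, compProd_map_condDistrib (by fun_prop), hfst]
  have hprod : (((signalLaw P μ).prod (N.map (Preorder.frestrictLe k))).map A).prod ξ =
      (((signalLaw P μ).prod (N.map (Preorder.frestrictLe k))).prod ξ).map (Prod.map A id) := by
    rw [← Measure.map_prod_map _ _ hA measurable_id, Measure.map_id]
  rw [hprod, ← hsplit, Measure.map_map (hA.prodMap measurable_id) (by fun_prop),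
    Measure.map_map (by fun_prop) (by fun_prop), hmmLaw, Measure.map_map (by fun_prop) hT]
  rfl

end HiddenMarkov

/-! ### The observation sequence and its finite segments -/

section Observations

variable {E : Type*} {n : ℕ}

theorem measurable_snd_obsSigma :
    Measurable[obsSigma E n] (Prod.snd : (ℕ → E) × (ℕ → EuclideanSpace ℝ (Fin n)) → _) := by
  rw [@measurable_pi_iff]
  intro k
  exact (comap_measurable _).mono (le_iSup (fun k : ℕ => MeasurableSpace.comap
    (fun ω : (ℕ → E) × (ℕ → EuclideanSpace ℝ (Fin n)) => ω.2 k) inferInstance) k) le_rfl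

theorem map_snd_absolutelyContinuous [MeasurableSpace E]
    {P Q : Measure ((ℕ → E) × (ℕ → EuclideanSpace ℝ (Fin n)))}
    (hac : P.trim (obsSigma_le E n) ≪ Q.trim (obsSigma_le E n)) :
    P.map Prod.snd ≪ Q.map Prod.snd := by
  refine Measure.AbsolutelyContinuous.mk fun s hs h0 => ?_
  have hs' := measurable_snd_obsSigma (E := E) hs
  rw [Measure.map_apply measurable_snd hs] at h0 ⊢
  have h1 : Q.trim (obsSigma_le E n) (Prod.snd ⁻¹' s) = 0 := by
    rwa [trim_measurableSet_eq _ hs']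
  have h2 := hac h1
  rwa [trim_measurableSet_eq _ hs'] at h2

theorem map_withDensity_of_leftInverse {A B : Type*} [MeasurableSpace A] [MeasurableSpace B]
    (ρ : Measure A) {e : A → B} (he : Measurable e) {m : B → A} (hm : Measurable m)
    (hme : ∀ a, m (e a) = a) {L : A → ℝ≥0∞} (hL : Measurable L) :
    (ρ.withDensity L).map e = (ρ.map e).withDensity fun b => L (m b) := by
  ext s hs
  rw [Measure.map_apply he hs, withDensity_apply _ (he hs), withDensity_apply _ hs,
    setLIntegral_map (f := fun b => L (m b)) hs (hL.comp hm) he]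
  simp only [hme]

/-- Appends the observation at time `k + 1` to the observations up to time `k`. -/
def appendObs (k : ℕ) (p : (Finset.Iic k → EuclideanSpace ℝ (Fin n)) × EuclideanSpace ℝ (Fin n)) :
    Finset.Iic (k + 1) → EuclideanSpace ℝ (Fin n) :=
  fun i => if hi : (i : ℕ) ≤ k then p.1 ⟨i, Finset.mem_Iic.2 hi⟩ else p.2

theorem measurable_appendObs (k : ℕ) : Measurable (appendObs (n := n) k) := by
  refine measurable_pi_iff.2 fun i => ?_
  unfold appendObs
  by_cases hi : (i : ℕ) ≤ k
  · simp only [hi, dite_true]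
    fun_prop
  · simp only [hi, dite_false]
    fun_prop

/-- Separates the observation at time `k + 1` from the observations up to time `k`. -/
def splitObs (k : ℕ) (w : Finset.Iic (k + 1) → EuclideanSpace ℝ (Fin n)) :
    (Finset.Iic k → EuclideanSpace ℝ (Fin n)) × EuclideanSpace ℝ (Fin n) :=
  (fun i => w ⟨i, Finset.mem_Iic.2 ((Finset.mem_Iic.1 i.2).trans (Nat.le_succ k))⟩,
    w ⟨k + 1, by simp⟩)

theorem measurable_splitObs (k : ℕ) : Measurable (splitObs (n := n) k) := by
  unfold splitObs
  fun_prop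

theorem appendObs_splitObs (k : ℕ) (w : Finset.Iic (k + 1) → EuclideanSpace ℝ (Fin n)) :
    appendObs k (splitObs k w) = w := by
  ext1 i
  unfold appendObs splitObs
  split_ifs with hi
  · rfl
  · have h1 := Finset.mem_Iic.1 i.2
    have h2 : i = ⟨k + 1, by simp⟩ := Subtype.ext (show (i : ℕ) = k + 1 by omega)
    rw [h2]

theorem appendObs_frestrictLe (k : ℕ) (y : ℕ → EuclideanSpace ℝ (Fin n)) :
    appendObs k (Preorder.frestrictLe k y, y (k + 1)) = Preorder.frestrictLe (k + 1) y :=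
  appendObs_splitObs k (Preorder.frestrictLe (k + 1) y)

end Observations

/-! ### Stability of the filter -/

theorem theorem2p2 {E : Type*} [MetricSpace E] [CompleteSpace E] [SecondCountableTopology E]
    [MeasurableSpace E] [BorelSpace E] [Nonempty E] {n : ℕ}
    -- the signal transition kernel, on which nothing is assumed
    (P : Kernel E E) [IsMarkovKernel P]
    -- the observation function and its uniformly continuous inverse
    (h : E → EuclideanSpace ℝ (Fin n)) (hh : Measurable h)
    (hinv : ∃ g : EuclideanSpace ℝ (Fin n) → E, UniformContinuous g ∧ ∀ x, g (h x) = x)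
    -- the noise law and its Lebesgue density, whose Fourier transform vanishes nowhere
    (ξ : Measure (EuclideanSpace ℝ (Fin n))) [IsProbabilityMeasure ξ]
    (q : EuclideanSpace ℝ (Fin n) → ℝ) (hq : Measurable q) (hq_nonneg : ∀ y, 0 ≤ q y)
    (hξ : ξ = volume.withDensity fun y => ENNReal.ofReal (q y))
    (hq_fourier : ∀ t, FourierTransform.fourier (fun y => (q y : ℂ)) t ≠ 0)
    -- the initial laws
    (μ ν : Measure E) [IsProbabilityMeasure μ] [IsProbabilityMeasure ν]
    (hac : (hmmLaw P h ξ μ).trim (obsSigma_le E n) ≪ (hmmLaw P h ξ ν).trim (obsSigma_le E n)) :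
    (∀ k, Integrable
      (fun ω => blDist (nonlinearFilter P h ξ μ k ω) (nonlinearFilter P h ξ ν k ω))
      (hmmLaw P h ξ μ)) ∧
    Filter.Tendsto
      (fun k => ∫ ω, blDist (nonlinearFilter P h ξ μ k ω) (nonlinearFilter P h ξ ν k ω)
        ∂(hmmLaw P h ξ μ))
      Filter.atTop (nhds 0) := by
  obtain ⟨g, hg, hgh⟩ := hinv
  have := isProbabilityMeasure_hmmLaw P ξ μ hh
  have := isProbabilityMeasure_hmmLaw P ξ ν hh
  have hbm : ∀ k, Measurable fun ω =>
      blDist (nonlinearFilter P h ξ μ k ω) (nonlinearFilter P h ξ ν k ω) := fun k =>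
    (measurable_blDist _ _).comp (measurable_obsUpTo k)
  refine ⟨fun k => Integrable.of_bound (hbm k).aestronglyMeasurable 2
    (Eventually.of_forall fun ω => ?_), ?_⟩
  · rw [Real.norm_of_nonneg (blDist_nonneg _ _)]
    unfold nonlinearFilter
    exact blDist_le_two _ _
  have hq1 : ∫⁻ y, ENNReal.ofReal (q y) = 1 := by
    rw [← setLIntegral_univ, ← withDensity_apply _ MeasurableSet.univ, ← hξ, measure_univ]
  have hsnd : ∀ μ : Measure E, [IsProbabilityMeasure μ] →
      IsProbabilityMeasure ((hmmLaw P h ξ μ).map Prod.snd) := fun μ _ =>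
    have := isProbabilityMeasure_hmmLaw P ξ μ hh
    Measure.isProbabilityMeasure_map measurable_snd.aemeasurable
  have := hsnd μ
  have := hsnd ν
  have hac' := map_snd_absolutelyContinuous hac
  set Pμ := (hmmLaw P h ξ μ).map Prod.snd
  set Pν := (hmmLaw P h ξ ν).map Prod.snd
  -- the increments of the likelihood ratio martingale of the observations
  let ℓ : ℕ → ℝ≥0∞ := fun k => ∫⁻ y, ‖(likelihood Pμ Pν (k + 1) (Preorder.frestrictLe (k + 1) y) : ℝ)
    - likelihood Pμ Pν k (Preorder.frestrictLe k y)‖ₑ ∂Pν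
  have hℓ : Tendsto ℓ atTop (𝓝 0) := tendsto_lintegral_likelihood_sub hac'
  -- one step of the filter costs `ε` plus a multiple, uniform in time, of such an increment
  have hmain : ∀ ε : ℝ≥0∞, ε ≠ 0 → ∃ C : ℝ≥0∞, C ≠ ∞ ∧ ∀ k,
      ∫⁻ ω, ENNReal.ofReal (blDist (nonlinearFilter P h ξ μ (k + 1) ω)
        (nonlinearFilter P h ξ ν (k + 1) ω)) ∂(hmmLaw P h ξ μ) ≤ ε + C * ℓ k := fun ε hε => by
    obtain ⟨C, hC, hG⟩ := exists_bound_unnormalized_update hh hg hgh hq hq_nonneg hq1 hq_fourier hε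
    refine ⟨C + 1, by simp [hC], fun k => ?_⟩
    let Z := Finset.Iic k → EuclideanSpace ℝ (Fin n)
    let U : (ℕ → E) × (ℕ → EuclideanSpace ℝ (Fin n)) → Z × EuclideanSpace ℝ (Fin n) :=
      fun ω => (obsUpTo k ω, ω.2 (k + 1))
    have hobs := measurable_obsUpTo (E := E) (n := n) k
    have hU : Measurable U := by fun_prop
    have hX : Measurable fun ω : (ℕ → E) × (ℕ → EuclideanSpace ℝ (Fin n)) => ω.1 (k + 1) := by
      fun_prop
    have happ := measurable_appendObs (n := n) k
    have happU : ∀ ω, appendObs k (U ω) = obsUpTo (k + 1) ω := fun ω => appendObs_frestrictLe k ω.2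
    -- the one-step prediction of the signal, and the filter as a function of `(Y_0, …, Y_k)` and
    -- `Y_{k+1}`
    let κ : ∀ (μ : Measure E) [IsProbabilityMeasure μ], Kernel Z E := fun μ _ =>
      condDistrib (fun ω => ω.1 (k + 1)) (obsUpTo k) (hmmLaw P h ξ μ)
    let π : ∀ (μ : Measure E) [IsProbabilityMeasure μ],
        Kernel (Z × EuclideanSpace ℝ (Fin n)) E := fun μ _ =>
      (condDistrib (fun ω => ω.1 (k + 1)) (obsUpTo (k + 1)) (hmmLaw P h ξ μ)).comap _ happ
    let lam : ∀ (μ : Measure E) [IsProbabilityMeasure μ], Measure Z := fun μ _ =>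
      (hmmLaw P h ξ μ).map (obsUpTo k)
    have hlamP : ∀ (μ : Measure E) [IsProbabilityMeasure μ], IsProbabilityMeasure (lam μ) :=
      fun μ _ =>
        have := isProbabilityMeasure_hmmLaw P ξ μ hh
        Measure.isProbabilityMeasure_map hobs.aemeasurable
    have hstep : ∀ (μ : Measure E) [IsProbabilityMeasure μ],
        (hmmLaw P h ξ μ).map (fun ω => (U ω, ω.1 (k + 1))) = stepLaw (lam μ) (κ μ) h ξ :=
      fun μ _ => map_hmmLaw_eq_stepLaw P ξ μ hh k
    have hfst : ∀ (μ : Measure E) [IsProbabilityMeasure μ],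
        (stepLaw (lam μ) (κ μ) h ξ).fst = (hmmLaw P h ξ μ).map U := fun μ _ => by
      rw [← hstep, Measure.fst_map_prodMk hX]
    have hπ : ∀ (μ : Measure E) [IsProbabilityMeasure μ],
        (stepLaw (lam μ) (κ μ) h ξ).fst ⊗ₘ π μ = stepLaw (lam μ) (κ μ) h ξ := fun μ _ => by
      rw [hfst, ← hstep]
      exact map_compProd_comap_condDistrib (hmmLaw P h ξ μ) hX (measurable_obsUpTo (k + 1)) hU happ
        happU (measurable_splitObs k) fun ω => rfl
    have hlam : ∀ (μ : Measure E) [IsProbabilityMeasure μ], lam μ =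
        ((hmmLaw P h ξ μ).map Prod.snd).map (Preorder.frestrictLe k) := fun μ _ => by
      rw [Measure.map_map (by fun_prop) measurable_snd]
      rfl
    have hUsnd : ∀ (μ : Measure E) [IsProbabilityMeasure μ], (hmmLaw P h ξ μ).map U =
        ((hmmLaw P h ξ μ).map Prod.snd).map (fun y => (Preorder.frestrictLe k y, y (k + 1))) :=
      fun μ _ => by
        rw [Measure.map_map (by fun_prop) measurable_snd]
        rfl
    have hL := withDensity_likelihood hac' k
    have hL' : (hmmLaw P h ξ μ).map U = ((hmmLaw P h ξ ν).map U).withDensity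
        fun p => likelihood Pμ Pν (k + 1) (appendObs k p) := by
      have hU' : ∀ (μ : Measure E) [IsProbabilityMeasure μ], (hmmLaw P h ξ μ).map U =
          (((hmmLaw P h ξ μ).map Prod.snd).map (Preorder.frestrictLe (k + 1))).map (splitObs k) :=
        fun μ _ => by
          rw [Measure.map_map (measurable_splitObs k) (by fun_prop), hUsnd]
          rfl
      rw [hU', hU', withDensity_likelihood hac' (k + 1)]
      exact map_withDensity_of_leftInverse _ (measurable_splitObs k) happ (appendObs_splitObs k)
        (measurable_likelihood Pμ Pν (k + 1)).coe_nnreal_ennreal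
    have hlamac : lam μ ≪ lam ν := by
      rw [hlam, hlam]
      exact hac'.map (by fun_prop)
    have key := lintegral_blDist_le hh hq hq_nonneg hξ hlamac (hπ μ) (hπ ν) hC hG
    have hBD := lintegral_obsDensity_sub_le (lam := lam μ) (lam' := lam ν) (κ := κ μ) (κ' := κ ν)
      hh hq hξ (measurable_likelihood Pμ Pν k)
      (L' := fun p => likelihood Pμ Pν (k + 1) (appendObs k p))
      ((measurable_likelihood Pμ Pν (k + 1)).comp happ)
      (by rw [hlam μ, hlam ν]; exact hL) (by rw [hfst, hfst]; exact hL')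
    have hℓk : ∫⁻ p, ‖(likelihood Pμ Pν (k + 1) (appendObs k p) : ℝ) - likelihood Pμ Pν k p.1‖ₑ
        ∂(stepLaw (lam ν) (κ ν) h ξ).fst = ℓ k := by
      have hm1 := measurable_likelihood Pμ Pν k
      have hm2 := (measurable_likelihood Pμ Pν (k + 1)).comp happ
      rw [hfst, hUsnd, lintegral_map (by fun_prop) (by fun_prop)]
      simp only [appendObs_frestrictLe]
      rfl
    have hleft : ∫⁻ ω, ENNReal.ofReal (blDist (nonlinearFilter P h ξ μ (k + 1) ω)
        (nonlinearFilter P h ξ ν (k + 1) ω)) ∂(hmmLaw P h ξ μ) =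
        ∫⁻ p, ENNReal.ofReal (blDist (π μ p) (π ν p)) ∂(stepLaw (lam μ) (κ μ) h ξ).fst := by
      rw [hfst, lintegral_map (measurable_blDist _ _).ennreal_ofReal hU]
      simp only [π, Kernel.comap_apply, happU]
      rfl
    rw [hleft]
    refine key.trans ?_
    gcongr
    exact hBD.trans hℓk.le
  rw [← tendsto_add_atTop_iff_nat 1]
  have hEq : ∀ k, ∫ ω, blDist (nonlinearFilter P h ξ μ k ω) (nonlinearFilter P h ξ ν k ω)
      ∂(hmmLaw P h ξ μ) = (∫⁻ ω, ENNReal.ofReal (blDist (nonlinearFilter P h ξ μ k ω)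
        (nonlinearFilter P h ξ ν k ω)) ∂(hmmLaw P h ξ μ)).toReal := fun k =>
    integral_eq_lintegral_of_nonneg_ae (Eventually.of_forall fun ω => blDist_nonneg _ _)
      (hbm k).aestronglyMeasurable
  simp only [hEq]
  rw [← ENNReal.toReal_zero]
  refine (ENNReal.continuousAt_toReal ENNReal.zero_ne_top).tendsto.comp ?_
  refine ENNReal.tendsto_nhds_zero.2 fun ε hε => ?_
  obtain ⟨C, hC, hCk⟩ := hmain (ε / 2) (ENNReal.half_pos hε.ne').ne'
  have hCl : Tendsto (fun k => C * ℓ k) atTop (𝓝 0) := by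
    simpa using ENNReal.Tendsto.const_mul hℓ (Or.inr hC)
  filter_upwards [hCl.eventually_lt_const (ENNReal.half_pos hε.ne')] with k hk
  calc _ ≤ ε / 2 + C * ℓ k := hCk k
    _ ≤ ε / 2 + ε / 2 := by gcongr
    _ = ε := ENNReal.add_halves ε
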